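/- Let $K$ be a compact (Hausdorff) Abelian group, written additively. For a subgroup $H\le K$ and a prime $p$ put $H[p]=\{x\in H: px=0\}$; let $\mathrm{Soc}(K)$ be the subgroup generated by all $K[p]$, $p$ prime; let $r_p(A)$ denote the $p$-rank $\dim_{\mathbb Z/p}A[p]$ of an Abelian group $A$; and for subgroups $G,H\le K$ put $\pi_{(H:G)}=\{p \text{ prime}: H[p]\not\le G\}$. A subgroup $G$ of a topological Abelian group $L$ is *locally essential* in $L$ if there is a neighbourhood $V$ of $0$ such that $G\cap S\neq\{0\}$ for every non-trivial closed subgroup $S$ of $L$ with $S\subseteq V$. It is *weakly essential* in $L$ if, for every prime $p$, $G\cap S\ne\{0\}$ for every infinite closed $p$-monothetic subgroup $S$ of $L$, where a topological group is *$p$-monothetic* if it has a dense cyclic subgroup and is either a cyclic $p$-group or topologically isomorphic to a subgroup of the $p$-adic integers $\mathbb Z_p$. A *$\delta$-subgroup* of a compact Abelian group $L$ is a closed totally disconnected subgroup $N$ such that $L/N$ is topologically isomorphic to a (possibly infinite, possibly trivial) power of the circle group $\mathbb T$. Finite-dimensional refers to the covering dimension. Let $G$ be a weakly essential subgroup of $K$.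 (a) If $G$ is locally essential in $K$, then $(*)$ for every prime $p$ the subgroup $G[p]$ of $K[p]$ is open, and there exists $n\in\mathbb N$ such that $r_p(K[p]/G[p])\le n$ for every prime $p$. (b) If $(*)$ holds and $\pi_{(K:G)}$ is finite, then $G$ is locally essential in $K$. (c) If $K_1:=\overline{\mathrm{Soc}(K)}$ is finite-dimensional, then the following conditions are equivalent: - (c$_1$) $G$ is locally essential in $K$; - (c$_2$) $(*)$ holds and $\pi_{(M:G)}$ is finite for every $\delta$-subgroup $M$ of $K$; - (c$_3$) $G\cap N$ is locally essential in $N$ for some $\delta$-subgroup $N$ of $K_1$; - (c$_3'$) $G\cap N$ is locally essential in $N$ for every $\delta$-subgroup $N$ of $K_1$. In particular, if $K$ is totally disconnected, then $G$ is locally essential in $K$ if and only if $\pi_{(K:G)}$ is finite and $G[p]$ is open in $K[p]$ for every prime $p$. -/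

import Mathlib

universe u

/-- `A` is monothetic: it has a dense cyclic subgroup. -/
def IsMonothetic (A : Type u) [AddCommGroup A] [TopologicalSpace A] : Prop :=
  ∃ a : A, Dense (AddSubgroup.zmultiples a : Set A)

/-- `A` is `p`-monothetic: it is monothetic, and either a cyclic `p`-group or topologically
isomorphic to a subgroup of the `p`-adic integers. -/
def IsPMonothetic (p : ℕ) [Fact p.Prime] (A : Type u) [AddCommGroup A] [TopologicalSpace A] :
    Prop :=
  IsMonothetic A ∧
    ((IsAddCyclic A ∧ ∃ k : ℕ, Nat.card A = p ^ k) ∨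
      ∃ H : AddSubgroup ℤ_[p], Nonempty (A ≃ₜ+ H))

/-- The finite open covers of `X` have finite open refinements in which every point lies in at
most `n + 1` members, i.e. the (Lebesgue) covering dimension satisfies `dim X ≤ n`. -/
def CoveringDimLE (X : Type u) [TopologicalSpace X] (n : ℕ) : Prop :=
  ∀ (k : ℕ) (U : Fin k → Set X), (∀ i, IsOpen (U i)) → (⋃ i, U i) = Set.univ →
    ∃ (m : ℕ) (V : Fin m → Set X), (∀ j, IsOpen (V j)) ∧ (⋃ j, V j) = Set.univ ∧
      (∀ j, ∃ i, V j ⊆ U i) ∧ ∀ x : X, {j | x ∈ V j}.ncard ≤ n + 1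

/-- `dim X < ∞` for the covering dimension. -/
def FiniteCoveringDim (X : Type u) [TopologicalSpace X] : Prop :=
  ∃ n : ℕ, CoveringDimLE X n

/-- `A` is a torus: topologically isomorphic to a (possibly infinite) power of the circle group.
Since `ι` embeds into `ι → 𝕋`, index types in the universe of `A` suffice. -/
def IsTorus (A : Type u) [AddCommGroup A] [TopologicalSpace A] : Prop :=
  ∃ ι : Type u, Nonempty (A ≃ₜ+ (ι → UnitAddCircle))

/-- The `p`-rank of an abelian group: the dimension of its `p`-torsion over `ℤ/p`. -/
noncomputable def pRank (p : ℕ) (A : Type u) [AddCommGroup A] : Cardinal.{u} :=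
  letI : Module (ZMod p) (AddSubgroup.torsionBy A (p : ℤ)) := AddSubgroup.torsionBy.zmodModule
  Module.rank (ZMod p) (AddSubgroup.torsionBy A (p : ℤ))

namespace AddSubgroup

variable {K : Type u} [AddCommGroup K]

/-- `H[p]`, as a subgroup of the ambient group `K`. -/
def pTorsion (H : AddSubgroup K) (p : ℕ) : AddSubgroup K :=
  H ⊓ torsionBy K (p : ℤ)

/-- `G[p]`, as a subgroup of `K[p]`. -/
def pTorsionIn (G : AddSubgroup K) (p : ℕ) : AddSubgroup (torsionBy K (p : ℤ)) :=
  (G.pTorsion p).addSubgroupOf (torsionBy K (p : ℤ))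

/-- The set `π_(H:G)` of all primes `p` such that `H[p]` is not contained in `G`. -/
def torsionPrimes (H G : AddSubgroup K) : Set ℕ :=
  {p | p.Prime ∧ ¬ H.pTorsion p ≤ G}

variable (K) in
/-- The socle of `K`, generated by all `K[p]`, `p` prime. -/
def socle : AddSubgroup K :=
  ⨆ p : Nat.Primes, torsionBy K ((p : ℕ) : ℤ)

variable [TopologicalSpace K]

/-- `G` is locally essential in `K`: for some neighbourhood `V` of `0`, it meets non-trivially
every non-trivial closed subgroup of `K` contained in `V`. -/
def IsLocallyEssential (G : AddSubgroup K) : Prop :=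
  ∃ V ∈ nhds (0 : K), ∀ S : AddSubgroup K, IsClosed (S : Set K) → S ≠ ⊥ → (S : Set K) ⊆ V →
    G ⊓ S ≠ ⊥

/-- `G` is weakly essential in `K`: for every prime `p` it meets non-trivially every infinite
closed `p`-monothetic subgroup of `K`. -/
def IsWeaklyEssential (G : AddSubgroup K) : Prop :=
  ∀ (p : ℕ) [Fact p.Prime] (S : AddSubgroup K), IsClosed (S : Set K) → (S : Set K).Infinite →
    IsPMonothetic p S → G ⊓ S ≠ ⊥

/-- `N` is a `δ`-subgroup of `K`: closed, totally disconnected, with `K ⧸ N` a torus. -/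
def IsDeltaSubgroup (N : AddSubgroup K) : Prop :=
  IsClosed (N : Set K) ∧ IsTotallyDisconnected (N : Set K) ∧ IsTorus (K ⧸ N)

/-- For every prime `p`, the subgroup `G[p]` of `K[p]` is open. -/
def PTorsionOpen (G : AddSubgroup K) : Prop :=
  ∀ p : ℕ, p.Prime → IsOpen (G.pTorsionIn p : Set (torsionBy K (p : ℤ)))

variable (K) in
/-- The closure of the socle of `K`. -/
def closedSocle [IsTopologicalAddGroup K] : AddSubgroup K :=
  (socle K).topologicalClosure

end AddSubgroup

/-!
Let `G` be weakly essential. A non-trivial closed subgroup of `K` contains an element of prime order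
or a copy of some `ℤ_p`, and in the second case it meets `G` by weak essentiality. Hence `G` is
locally essential exactly if it contains every element of prime order that generates a subgroup of
some fixed neighbourhood `V` of `0`; a further neighbourhood may be described by finitely many
characters, as the circle has no small subgroups. Finitely many characters cut out from `K[p]` a
subgroup of index at most `p ^ n` with `n` independent of `p`, which gives (a); in a closed totally
disconnected subgroup they have finite order, so that all but finitely many primes drop out.

Both the elements of order `p` or copies of `ℤ_p` and the `δ`-subgroups come from duality: a
homomorphism from the group of characters to the circle is evaluation at a point. To construct a
point, or a quotient that is a torus, it therefore suffices to extend homomorphisms to divisible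
groups. Enough characters exist because the convolution operator of a self-adjoint function has
positive spectral radius, so that Gelfand theory provides a multiplicative functional.

Elements of prime order lie in the closed socle `K₁`. A `δ`-subgroup `N` of `K₁` is the kernel of a
family of independent characters, and `n` independent characters yield a continuous map from a
cube to `K₁` whose opposite faces are separated in `K₁`, so that `dim K₁ ≥ n` by the covering
theorem of Lebesgue. If `K₁` is finite-dimensional, the family is therefore finite, and all small
elements of prime order lie in `N`.
-/

namespace CompactAbelian

open MeasureTheory Filter Topology ComplexConjugate

section Translation

variable {K : Type*} [AddCommGroup K] [TopologicalSpace K] [IsTopologicalAddGroup K]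

/-- The reflection `x ↦ conj (f (-x))`, the involution of the convolution algebra. -/
noncomputable def reflect (f : C(K, ℂ)) : C(K, ℂ) where
  toFun x := conj (f (-x))
  continuous_toFun := by fun_prop

/-- The translate of `f` by `a`, on which a character acts by its value at `a`. -/
noncomputable def translate (a : K) (f : C(K, ℂ)) : C(K, ℂ) where
  toFun x := f (x + a)
  continuous_toFun := by fun_prop

theorem continuous_translate (f : C(K, ℂ)) : Continuous fun a => translate a f := by
  let F : C(K × K, ℂ) := ⟨fun z => f (z.2 + z.1), by fun_prop⟩
  exact F.curry.continuous

theorem translate_zero (f : C(K, ℂ)) : translate 0 f = f := by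
  ext x
  exact congrArg f (add_zero x)

theorem translate_translate (a b : K) (f : C(K, ℂ)) :
    translate a (translate b f) = translate (a + b) f := by
  ext x
  exact congrArg f (add_assoc x a b)

theorem reflect_reflect (f : C(K, ℂ)) : reflect (reflect f) = f := by
  ext x
  simp [reflect]

end Translation

theorem integrable_of_continuous_compactSpace {X : Type*} [TopologicalSpace X]
    [CompactSpace X] [MeasurableSpace X] [BorelSpace X] (μ : Measure X) [IsFiniteMeasure μ]
    {f : X → ℂ} (hf : Continuous f) : Integrable f μ :=
  hf.integrable_of_hasCompactSupport (HasCompactSupport.of_compactSpace f)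

/-- Integration against a finite measure, as a continuous functional on `C(X, ℂ)`. -/
noncomputable def integralFunctional {X : Type*} [TopologicalSpace X] [CompactSpace X]
    [MeasurableSpace X] [BorelSpace X] (μ : Measure X) [IsFiniteMeasure μ] :
    C(X, ℂ) →L[ℂ] ℂ :=
  LinearMap.mkContinuous
    { toFun := fun f => ∫ x, f x ∂μ
      map_add' := fun f g => integral_add (integrable_of_continuous_compactSpace μ f.continuous)
        (integrable_of_continuous_compactSpace μ g.continuous)
      map_smul' := fun c f => integral_const_mul c f }
    (μ.real Set.univ) (fun f => by
      rw [mul_comm]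
      exact norm_integral_le_of_norm_le_const (Eventually.of_forall f.norm_coe_le_norm))

section Convolution

variable {K : Type*} [AddCommGroup K] [TopologicalSpace K] [IsTopologicalAddGroup K]
  [CompactSpace K] [MeasurableSpace K] [BorelSpace K] (μ : Measure K) [μ.IsAddHaarMeasure]

/-- The convolution of continuous functions on a compact abelian group. -/
noncomputable def convolve (f g : C(K, ℂ)) : C(K, ℂ) where
  toFun x := ∫ y, f (x - y) * g y ∂μ
  continuous_toFun := by
    let F : C(K × K, ℂ) := ⟨fun z => f (z.1 - z.2) * g z.2, by fun_prop⟩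
    exact (integralFunctional μ).continuous.comp F.curry.continuous

theorem convolve_apply (f g : C(K, ℂ)) (x : K) :
    convolve μ f g x = ∫ y, f (x - y) * g y ∂μ := rfl

theorem norm_convolve_le (f g : C(K, ℂ)) :
    ‖convolve μ f g‖ ≤ μ.real Set.univ * ‖f‖ * ‖g‖ := by
  refine (ContinuousMap.norm_le _ (by positivity)).2 fun x => ?_
  rw [convolve_apply]
  calc _ ≤ ‖f‖ * ‖g‖ * μ.real Set.univ := by
        refine norm_integral_le_of_norm_le_const (Eventually.of_forall fun y => ?_)
        rw [norm_mul]
        exact mul_le_mul (f.norm_coe_le_norm _) (g.norm_coe_le_norm _) (norm_nonneg _)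
          (norm_nonneg _)
    _ = _ := by ring

/-- Convolution as a bounded bilinear operator on `C(K, ℂ)`. -/
noncomputable def convolutionOp : C(K, ℂ) →L[ℂ] C(K, ℂ) →L[ℂ] C(K, ℂ) :=
  LinearMap.mkContinuous₂
    (LinearMap.mk₂ ℂ (convolve μ)
      (fun f f' g => by
        ext x
        simp only [convolve_apply, ContinuousMap.add_apply, add_mul]
        exact integral_add (integrable_of_continuous_compactSpace μ (by fun_prop))
          (integrable_of_continuous_compactSpace μ (by fun_prop)))
      (fun c f g => by
        ext x
        simp only [convolve_apply, ContinuousMap.smul_apply, smul_eq_mul, mul_assoc]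
        exact integral_const_mul c _)
      (fun f g g' => by
        ext x
        simp only [convolve_apply, ContinuousMap.add_apply, mul_add]
        exact integral_add (integrable_of_continuous_compactSpace μ (by fun_prop))
          (integrable_of_continuous_compactSpace μ (by fun_prop)))
      (fun c f g => by
        ext x
        simp only [convolve_apply, ContinuousMap.smul_apply, smul_eq_mul, mul_left_comm _ c]
        exact integral_const_mul c _))
    (μ.real Set.univ) (norm_convolve_le μ)

theorem convolutionOp_apply (f g : C(K, ℂ)) : convolutionOp μ f g = convolve μ f g := rfl

theorem convolve_assoc (f g h : C(K, ℂ)) :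
    convolve μ f (convolve μ g h) = convolve μ (convolve μ f g) h := by
  ext x
  simp only [convolve_apply, ← integral_const_mul, ← integral_mul_const]
  rw [integral_integral_swap_of_hasCompactSupport _ (HasCompactSupport.of_compactSpace _)]
  · congr 1
    ext z
    rw [← integral_sub_right_eq_self (fun y => f (x - z - y) * g y * h z) z]
    congr 1
    ext y
    rw [show x - z - (y - z) = x - y by abel, mul_assoc]
  · simp only [Function.uncurry_def]
    fun_prop

theorem translate_convolve (a : K) (f g : C(K, ℂ)) :
    convolve μ (translate a f) g = translate a (convolve μ f g) := by
  ext x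
  simp only [convolve_apply, translate, ContinuousMap.coe_mk, sub_add_eq_add_sub]

theorem convolutionOp_mul (f g : C(K, ℂ)) :
    convolutionOp μ f * convolutionOp μ g = convolutionOp μ (convolve μ f g) :=
  ContinuousLinearMap.ext fun h => convolve_assoc μ f g h

variable [μ.IsNegInvariant]

theorem convolve_comm (f g : C(K, ℂ)) : convolve μ f g = convolve μ g f := by
  ext x
  simp only [convolve_apply]
  rw [← integral_sub_left_eq_self _ μ x]
  simp [mul_comm]

theorem convolutionOp_commute (f g : C(K, ℂ)) :
    convolutionOp μ f * convolutionOp μ g = convolutionOp μ g * convolutionOp μ f := by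
  rw [convolutionOp_mul, convolutionOp_mul, convolve_comm]

theorem reflect_convolve (f g : C(K, ℂ)) :
    reflect (convolve μ f g) = convolve μ (reflect f) (reflect g) := by
  ext x
  simp only [reflect, convolve_apply, ContinuousMap.coe_mk, ← integral_conj, map_mul]
  rw [← integral_neg_eq_self]
  simp [neg_add_eq_sub]

end Convolution

section SpectralRadius

theorem ofReal_le_spectralRadius_of_le_norm_pow {A : Type*} [NormedRing A] [NormedAlgebra ℂ A]
    [CompleteSpace A] (a : A) {c r : ℝ} (hc : 0 < c) (hr : 0 ≤ r)
    (h : ∀ k : ℕ, c * r ^ k ≤ ‖a ^ k‖) : ENNReal.ofReal r ≤ spectralRadius ℂ a := by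
  have hroot : Tendsto (fun n : ℕ => ENNReal.ofReal (c ^ (1 / n : ℝ) * r)) atTop
      (𝓝 (ENNReal.ofReal r)) := by
    have : Tendsto (fun n : ℕ => c ^ (1 / n : ℝ)) atTop (𝓝 1) := by
      simpa only [Real.rpow_zero] using
        tendsto_const_nhds.rpow tendsto_one_div_atTop_nhds_zero_nat (Or.inl hc.ne')
    simpa only [one_mul] using ENNReal.tendsto_ofReal (this.mul_const r)
  refine le_of_tendsto_of_tendsto hroot
    (spectrum.pow_norm_pow_one_div_tendsto_nhds_spectralRadius a) ?_
  filter_upwards [eventually_ne_atTop 0] with n hn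
  refine ENNReal.ofReal_le_ofReal ?_
  calc c ^ (1 / n : ℝ) * r = (c * r ^ n) ^ (1 / n : ℝ) := by
        rw [Real.mul_rpow hc.le (by positivity), one_div, Real.pow_rpow_inv_natCast hr hn]
    _ ≤ ‖a ^ n‖ ^ (1 / n : ℝ) := Real.rpow_le_rpow (by positivity) (h n) (by positivity)

theorem exists_character_ne_zero_of_spectralRadius_ne_zero {A : Type*} [NormedCommRing A]
    [NormedAlgebra ℂ A] [CompleteSpace A] {a : A} (ha : spectralRadius ℂ a ≠ 0) :
    ∃ φ : WeakDual.characterSpace ℂ A, φ a ≠ 0 := by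
  contrapose! ha
  refine le_antisymm (iSup₂_le fun z hz => ?_) bot_le
  obtain ⟨φ, rfl⟩ := WeakDual.CharacterSpace.mem_spectrum_iff_exists.1 hz
  simp [ha φ]

theorem le_norm_iterate_of_symmetric {𝕜 E : Type*} [RCLike 𝕜] [NormedAddCommGroup E]
    [InnerProductSpace 𝕜 E] (v : ℕ → E)
    (hv : ∀ k l, inner 𝕜 (v (k + 1)) (v l) = inner 𝕜 (v k) (v (l + 1)))
    (h0 : v 0 ≠ 0) (h1 : v 1 ≠ 0) (k : ℕ) :
    ‖v 0‖ * (‖v 1‖ / ‖v 0‖) ^ k ≤ ‖v k‖ := by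
  have norm_zero_pos : 0 < ‖v 0‖ := norm_pos_iff.2 h0
  have norm_one_pos : 0 < ‖v 1‖ := norm_pos_iff.2 h1
  have log_convex (k : ℕ) : ‖v (k + 1)‖ * ‖v (k + 1)‖ ≤ ‖v k‖ * ‖v (k + 2)‖ := by
    rw [← sq, ← inner_self_eq_norm_sq (𝕜 := 𝕜), hv]
    exact (RCLike.re_le_norm _).trans (norm_inner_le_norm _ _)
  have ratio (k : ℕ) : 0 < ‖v k‖ ∧ ‖v 1‖ / ‖v 0‖ * ‖v k‖ ≤ ‖v (k + 1)‖ := by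
    induction k with
    | zero => exact ⟨norm_zero_pos, by rw [div_mul_cancel₀ _ norm_zero_pos.ne']⟩
    | succ k ih =>
      have pos : 0 < ‖v (k + 1)‖ :=
        (mul_pos (div_pos norm_one_pos norm_zero_pos) ih.1).trans_le ih.2
      refine ⟨pos, le_of_mul_le_mul_left ?_ ih.1⟩
      calc ‖v k‖ * (‖v 1‖ / ‖v 0‖ * ‖v (k + 1)‖)
          = ‖v 1‖ / ‖v 0‖ * ‖v k‖ * ‖v (k + 1)‖ := by ring
        _ ≤ ‖v (k + 1)‖ * ‖v (k + 1)‖ := mul_le_mul_of_nonneg_right ih.2 pos.le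
        _ ≤ ‖v k‖ * ‖v (k + 2)‖ := log_convex k
  induction k with
  | zero => simp
  | succ k ih =>
    calc ‖v 0‖ * (‖v 1‖ / ‖v 0‖) ^ (k + 1)
        = ‖v 1‖ / ‖v 0‖ * (‖v 0‖ * (‖v 1‖ / ‖v 0‖) ^ k) := by ring
      _ ≤ ‖v 1‖ / ‖v 0‖ * ‖v k‖ := by gcongr
      _ ≤ ‖v (k + 1)‖ := (ratio k).2

end SpectralRadius

section Gelfand

theorem toLp_ne_zero {X : Type*} [TopologicalSpace X] [CompactSpace X] [MeasurableSpace X]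
    [BorelSpace X] (μ : Measure X) [IsFiniteMeasure μ] [μ.IsOpenPosMeasure] {u : C(X, ℂ)}
    (hu : u ≠ 0) : ContinuousMap.toLp 2 μ ℂ u ≠ 0 := fun h =>
  hu (ContinuousMap.toLp_injective (𝕜 := ℂ) (p := 2) μ (by rw [h, map_zero]))

variable {K : Type*} [AddCommGroup K] [TopologicalSpace K] [IsTopologicalAddGroup K]
  [CompactSpace K] [MeasurableSpace K] [BorelSpace K] (μ : Measure K) [μ.IsAddHaarMeasure]

theorem convolve_reflect_self_zero (u : C(K, ℂ)) :
    convolve μ (reflect u) u 0 = inner ℂ (ContinuousMap.toLp 2 μ ℂ u)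
      (ContinuousMap.toLp 2 μ ℂ u) := by
  rw [ContinuousMap.inner_toLp, convolve_apply]
  simp [reflect, mul_comm]

theorem convolve_reflect_self_ne_zero {u : C(K, ℂ)} (hu : u ≠ 0) :
    convolve μ (reflect u) u ≠ 0 := by
  intro h
  have := convolve_reflect_self_zero μ u
  rw [h, ContinuousMap.zero_apply] at this
  exact toLp_ne_zero μ hu (inner_self_eq_zero.1 this.symm)

theorem inner_convolve_of_reflect_eq {h : C(K, ℂ)} (hh : reflect h = h) (a b : C(K, ℂ)) :
    inner ℂ (ContinuousMap.toLp 2 μ ℂ (convolve μ h a)) (ContinuousMap.toLp 2 μ ℂ b) =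
      inner ℂ (ContinuousMap.toLp 2 μ ℂ a) (ContinuousMap.toLp 2 μ ℂ (convolve μ h b)) := by
  have h' : ∀ x, conj (h x) = h (-x) := fun x => by
    conv_rhs => rw [← hh]
    simp [reflect]
  rw [ContinuousMap.inner_toLp, ContinuousMap.inner_toLp]
  simp only [convolve_apply, ← integral_conj, ← integral_const_mul, ← integral_mul_const]
  rw [integral_integral_swap_of_hasCompactSupport _ (HasCompactSupport.of_compactSpace _)]
  · congr 1
    ext y
    congr 1
    ext x
    simp only [map_mul, h', neg_sub]
    ring
  · simp only [Function.uncurry_def]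
    fun_prop

theorem toLp_convolutionOp_pow_symmetric {h : C(K, ℂ)} (hh : reflect h = h) (k l : ℕ) :
    inner ℂ (ContinuousMap.toLp 2 μ ℂ ((convolutionOp μ h ^ (k + 1)) h))
        (ContinuousMap.toLp 2 μ ℂ ((convolutionOp μ h ^ l) h)) =
      inner ℂ (ContinuousMap.toLp 2 μ ℂ ((convolutionOp μ h ^ k) h))
        (ContinuousMap.toLp 2 μ ℂ ((convolutionOp μ h ^ (l + 1)) h)) := by
  simp only [pow_succ', mul_apply_eq_comp, convolutionOp_apply]
  exact inner_convolve_of_reflect_eq μ hh _ _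

theorem exists_le_norm_convolutionOp_pow {h : C(K, ℂ)} (hh : reflect h = h) (h0 : h ≠ 0) :
    ∃ c r : ℝ, 0 < c ∧ 0 < r ∧ ∀ k : ℕ, c * r ^ k ≤ ‖convolutionOp μ h ^ k‖ := by
  let J : C(K, ℂ) →L[ℂ] Lp ℂ 2 μ := ContinuousMap.toLp 2 μ ℂ
  let v : ℕ → Lp ℂ 2 μ := fun k => J ((convolutionOp μ h ^ k) h)
  have hv0 : v 0 ≠ 0 := toLp_ne_zero μ h0
  have hv1 : v 1 ≠ 0 := by
    refine toLp_ne_zero μ ?_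
    rw [pow_one, convolutionOp_apply]
    conv => enter [1, 2]; rw [← hh]
    exact convolve_reflect_self_ne_zero μ h0
  have hJ : 0 < ‖J‖ * ‖h‖ := (norm_pos_iff.2 hv0).trans_le (J.le_opNorm _)
  refine ⟨‖v 0‖ / (‖J‖ * ‖h‖), ‖v 1‖ / ‖v 0‖, div_pos (norm_pos_iff.2 hv0) hJ,
    div_pos (norm_pos_iff.2 hv1) (norm_pos_iff.2 hv0), fun k => ?_⟩
  rw [div_mul_eq_mul_div, div_le_iff₀ hJ]
  calc ‖v 0‖ * (‖v 1‖ / ‖v 0‖) ^ k ≤ ‖v k‖ :=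
        le_norm_iterate_of_symmetric v (toLp_convolutionOp_pow_symmetric μ hh) hv0 hv1 k
    _ ≤ ‖J‖ * ‖(convolutionOp μ h ^ k) h‖ := J.le_opNorm _
    _ ≤ ‖J‖ * (‖convolutionOp μ h ^ k‖ * ‖h‖) := by
        gcongr
        exact ContinuousLinearMap.le_opNorm _ _
    _ = ‖convolutionOp μ h ^ k‖ * (‖J‖ * ‖h‖) := by ring

theorem exists_multiplicative_functional_ne_zero [μ.IsNegInvariant] {h : C(K, ℂ)}
    (hh : reflect h = h) (h0 : h ≠ 0) :
    ∃ Φ : C(K, ℂ) →L[ℂ] ℂ, (∀ f g, Φ (convolve μ f g) = Φ f * Φ g) ∧ Φ h ≠ 0 := by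
  let S : Set (C(K, ℂ) →L[ℂ] C(K, ℂ)) := Set.range (convolutionOp μ)
  let B := (Algebra.adjoin ℂ S).topologicalClosure
  have hcomm : ∀ x y : Algebra.adjoin ℂ S, x * y = y * x := by
    have := Algebra.isMulCommutative_adjoin ℂ (s := S) (by
      rintro _ ⟨f, rfl⟩ _ ⟨g, rfl⟩
      exact convolutionOp_commute μ f g)
    exact fun x y => mul_comm' x y
  let _ : NormedCommRing B :=
    { (inferInstance : NormedRing B) with
      mul_comm := ((Algebra.adjoin ℂ S).commRingTopologicalClosure hcomm).mul_comm }
  have : CompleteSpace B :=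
    (Subalgebra.isClosed_topologicalClosure _).completeSpace_coe
  have hmem : ∀ f, convolutionOp μ f ∈ B := fun f =>
    Subalgebra.le_topologicalClosure _ (Algebra.subset_adjoin ⟨f, rfl⟩)
  let L : C(K, ℂ) →L[ℂ] B := (convolutionOp μ).codRestrict (Subalgebra.toSubmodule B) hmem
  obtain ⟨c, r, hc, hr, hgrowth⟩ := exists_le_norm_convolutionOp_pow μ hh h0
  have hradius : spectralRadius ℂ (L h) ≠ 0 := ((ENNReal.ofReal_pos.2 hr).trans_le
    (ofReal_le_spectralRadius_of_le_norm_pow (L h) hc hr.le hgrowth)).ne'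
  obtain ⟨φ, hφ⟩ := exists_character_ne_zero_of_spectralRadius_ne_zero hradius
  refine ⟨(WeakDual.CharacterSpace.toCLM φ).comp L, fun f g => ?_, hφ⟩
  have hmul : L (convolve μ f g) = L f * L g := Subtype.ext (convolutionOp_mul μ f g).symm
  change φ (L _) = φ (L f) * φ (L g)
  rw [hmul, map_mul]

end Gelfand

section Separation

variable {K : Type*} [AddCommGroup K] [TopologicalSpace K] [IsTopologicalAddGroup K]
  [CompactSpace K]

theorem norm_eq_one_of_continuous_multiplicative {M : Type*} [AddGroup M] [TopologicalSpace M]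
    [CompactSpace M] {χ : M → ℂ} (hc : Continuous χ) (h0 : χ 0 = 1)
    (ha : ∀ x y, χ (x + y) = χ x * χ y) (x : M) : ‖χ x‖ = 1 := by
  have norm_le_one (x : M) : ‖χ x‖ ≤ 1 := by
    obtain ⟨C, hC⟩ := (isCompact_range hc).isBounded.exists_norm_le
    have map_nsmul (n : ℕ) : χ (n • x) = χ x ^ n := by
      induction n with
      | zero => simp [h0]
      | succ n ih => rw [succ_nsmul, ha, ih, pow_succ]
    by_contra! hx
    obtain ⟨n, hn⟩ := pow_unbounded_of_one_lt C hx
    rw [← norm_pow, ← map_nsmul] at hn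
    exact hn.not_ge (hC _ ⟨n • x, rfl⟩)
  have hinv : ‖χ x‖ * ‖χ (-x)‖ = 1 := by rw [← norm_mul, ← ha, add_neg_cancel, h0, norm_one]
  nlinarith [norm_le_one x, norm_le_one (-x), norm_nonneg (χ x), norm_nonneg (χ (-x))]

theorem exists_character_of_continuous_multiplicative {M : Type*} [AddGroup M]
    [TopologicalSpace M] [CompactSpace M] {χ : M → ℂ} (hc : Continuous χ) (h0 : χ 0 = 1)
    (ha : ∀ x y, χ (x + y) = χ x * χ y) :
    ∃ ψ : M →ₜ+ UnitAddCircle, ∀ x, (AddCircle.toCircle (ψ x) : ℂ) = χ x := by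
  let e := AddCircle.homeomorphCircle (T := (1 : ℝ)) one_ne_zero
  let c : M → Circle := fun x => ⟨χ x, by
    rw [← SetLike.mem_coe, Submonoid.coe_unitSphere, mem_sphere_zero_iff_norm]
    exact norm_eq_one_of_continuous_multiplicative hc h0 ha x⟩
  have hcc : Continuous c := Continuous.subtype_mk hc _
  have he : ∀ z, AddCircle.toCircle (e.symm z) = z := fun z => by
    rw [← AddCircle.homeomorphCircle_apply one_ne_zero]
    exact e.apply_symm_apply z
  refine ⟨ContinuousAddMonoidHom.mk (AddMonoidHom.mk' (fun x => e.symm (c x)) fun x y => ?_)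
    (e.symm.continuous.comp hcc), fun x => congrArg Subtype.val (he (c x))⟩
  refine AddCircle.injective_toCircle one_ne_zero ?_
  rw [AddCircle.toCircle_add, he, he, he]
  exact Subtype.ext (ha x y)

/-- A functional multiplicative for the convolution is integration against a character, which is
recovered from its effect on translates. -/
theorem exists_character_map_translate [MeasurableSpace K] [BorelSpace K] (μ : Measure K)
    [μ.IsAddHaarMeasure] [μ.IsNegInvariant] {Φ : C(K, ℂ) →L[ℂ] ℂ}
    (hmul : ∀ f g, Φ (convolve μ f g) = Φ f * Φ g) {w : C(K, ℂ)} (hw : Φ w ≠ 0) :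
    ∃ ψ : K →ₜ+ UnitAddCircle, ∀ a g, Φ (translate a g) = AddCircle.toCircle (ψ a) * Φ g := by
  have htr (a : K) (g₁ g₂ : C(K, ℂ)) : Φ (translate a g₁) * Φ g₂ = Φ g₁ * Φ (translate a g₂) := by
    rw [← hmul, ← hmul, translate_convolve, convolve_comm μ g₁ (translate a g₂),
      translate_convolve, convolve_comm μ g₁]
  let χ : K → ℂ := fun a => Φ (translate a w) / Φ w
  have hχ (a : K) (g : C(K, ℂ)) : Φ (translate a g) = χ a * Φ g := by
    rw [div_mul_eq_mul_div, eq_div_iff hw, htr, mul_comm]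
  obtain ⟨ψ, hψ⟩ := exists_character_of_continuous_multiplicative (χ := χ)
    ((Φ.continuous.comp (continuous_translate w)).div_const _)
    (by simp only [χ, translate_zero, div_self hw])
    (fun a b => mul_right_cancel₀ hw (by rw [← hχ, ← translate_translate, hχ, hχ, mul_assoc]))
  exact ⟨ψ, fun a g => by rw [hψ, hχ]⟩

variable [T2Space K]

theorem exists_translate_ne {x : K} (hx : x ≠ 0) : ∃ f : C(K, ℂ), translate x f ≠ f := by
  obtain ⟨f, hf0, hfx, -⟩ := exists_continuous_zero_one_of_isClosed (X := K)
    (isClosed_singleton (x := 0)) (isClosed_singleton (x := x)) (by simpa using hx.symm)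
  refine ⟨⟨fun y => (f y : ℂ), by fun_prop⟩, fun h => ?_⟩
  have hx0 := congrArg (fun g : C(K, ℂ) => g 0) h
  simp [translate, hf0 (Set.mem_singleton 0), hfx (Set.mem_singleton x)] at hx0

theorem exists_character_ne_zero {x : K} (hx : x ≠ 0) : ∃ ψ : K →ₜ+ UnitAddCircle, ψ x ≠ 0 := by
  borelize K
  let μ : Measure K := Measure.addHaar
  obtain ⟨f, hf⟩ := exists_translate_ne hx
  let w : C(K, ℂ) := translate x f - f
  obtain ⟨Φ, hmul, hΦ⟩ := exists_multiplicative_functional_ne_zero μ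
    (h := convolve μ (reflect w) w)
    (by rw [reflect_convolve, reflect_reflect, convolve_comm])
    (convolve_reflect_self_ne_zero μ (sub_ne_zero.2 hf))
  have hw : Φ w ≠ 0 := by
    rw [hmul] at hΦ
    exact right_ne_zero_of_mul hΦ
  obtain ⟨ψ, hψ⟩ := exists_character_map_translate μ hmul hw
  refine ⟨ψ, fun h => hw ?_⟩
  rw [map_sub, hψ, h, AddCircle.toCircle_zero, Circle.coe_one, one_mul, sub_self]

theorem eq_of_forall_character {x y : K} (h : ∀ χ : K →ₜ+ UnitAddCircle, χ x = χ y) : x = y := by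
  by_contra hxy
  obtain ⟨χ, hχ⟩ := exists_character_ne_zero (sub_ne_zero.2 hxy)
  exact hχ (by rw [map_sub, h, sub_self])

end Separation

section Orthogonality

/-- A character, as a complex-valued function; sums of characters become products of functions. -/
noncomputable def characterFun (M : Type*) [AddCommGroup M] [TopologicalSpace M] :
    Multiplicative (M →ₜ+ UnitAddCircle) →* C(M, ℂ) where
  toFun ψ := ⟨fun x => AddCircle.toCircle (ψ.toAdd x), by fun_prop⟩
  map_one' := ContinuousMap.ext fun _ => congrArg Circle.coeHom AddCircle.toCircle_zero
  map_mul' _ _ := ContinuousMap.ext fun _ => congrArg Circle.coeHom (AddCircle.toCircle_add _ _)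

theorem star_characterFun {M : Type*} [AddCommGroup M] [TopologicalSpace M]
    (ψ : M →ₜ+ UnitAddCircle) :
    star (characterFun M (.ofAdd ψ)) = characterFun M (.ofAdd (-ψ)) := by
  ext x
  exact ((congrArg Circle.coeHom (AddCircle.toCircle_neg (ψ x))).trans
    (Circle.coe_inv_eq_conj _)).symm

theorem coe_toCircle_injective :
    Function.Injective fun t : UnitAddCircle => (AddCircle.toCircle t : ℂ) :=
  Subtype.val_injective.comp (AddCircle.injective_toCircle one_ne_zero)

theorem dense_span_characterFun {M : Type*} [AddCommGroup M] [TopologicalSpace M]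
    [CompactSpace M] {S : AddSubgroup (M →ₜ+ UnitAddCircle)}
    (hS : ∀ x ≠ 0, ∃ ψ ∈ S, ψ x ≠ 0) :
    Dense (Submodule.span ℂ (S.toSubgroup.toSubmonoid.map (characterFun M) : Set C(M, ℂ)) :
      Set C(M, ℂ)) := by
  let T : Submonoid C(M, ℂ) := S.toSubgroup.toSubmonoid.map (characterFun M)
  have hT : Submodule.span ℂ (T : Set C(M, ℂ)) =
      (Algebra.adjoin ℂ (T : Set C(M, ℂ))).toSubmodule := by
    rw [Algebra.adjoin_eq_span, Submonoid.closure_eq]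
  let A : StarSubalgebra ℂ C(M, ℂ) :=
    { Algebra.adjoin ℂ (T : Set C(M, ℂ)) with
      star_mem' := fun {f} hf => by
        refine (Algebra.adjoin_le (S := star (Algebra.adjoin ℂ (T : Set C(M, ℂ)))) ?_) hf
        rintro _ ⟨ψ, hψ, rfl⟩
        exact Algebra.subset_adjoin
          ⟨.ofAdd (-ψ.toAdd), S.neg_mem hψ, (star_characterFun ψ.toAdd).symm⟩ }
  have hA : A.SeparatesPoints := fun x y hxy => by
    obtain ⟨ψ, hψ, hne⟩ := hS (x - y) (sub_ne_zero.2 hxy)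
    refine ⟨_, ⟨characterFun M (.ofAdd ψ), Algebra.subset_adjoin ⟨.ofAdd ψ, hψ, rfl⟩, rfl⟩,
      fun h => hne ?_⟩
    rw [map_sub, sub_eq_zero]
    exact coe_toCircle_injective h
  have htop := ContinuousMap.starSubalgebra_topologicalClosure_eq_top_of_separatesPoints A hA
  rw [hT]
  exact dense_iff_closure_eq.2 (congrArg SetLike.coe htop)

theorem integralFunctional_one_ne_zero {X : Type*} [TopologicalSpace X] [CompactSpace X]
    [MeasurableSpace X] [BorelSpace X] (μ : Measure X) [IsFiniteMeasure μ] [NeZero μ] :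
    integralFunctional μ 1 ≠ 0 := by
  change ∫ _, (1 : ℂ) ∂μ ≠ 0
  simp [measureReal_eq_zero_iff, NeZero.ne μ]

variable {K : Type*} [AddCommGroup K] [TopologicalSpace K] [IsTopologicalAddGroup K]
  [CompactSpace K]

theorem integralFunctional_characterFun_eq_zero [MeasurableSpace K] [BorelSpace K]
    (μ : Measure K) [μ.IsAddHaarMeasure] {ψ : K →ₜ+ UnitAddCircle} (hψ : ψ ≠ 0) :
    integralFunctional μ (characterFun K (.ofAdd ψ)) = 0 := by
  obtain ⟨a, ha⟩ : ∃ a, ψ a ≠ 0 := by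
    by_contra! h
    exact hψ (ContinuousAddMonoidHom.ext h)
  have hne : (AddCircle.toCircle (ψ a) : ℂ) ≠ 1 := fun h =>
    ha (coe_toCircle_injective (by simpa using h))
  have invariance : (AddCircle.toCircle (ψ a) : ℂ) * ∫ x, (AddCircle.toCircle (ψ x) : ℂ) ∂μ =
      ∫ x, (AddCircle.toCircle (ψ x) : ℂ) ∂μ := by
    rw [← integral_const_mul,
      ← integral_add_left_eq_self (fun x => (AddCircle.toCircle (ψ x) : ℂ)) a]
    simp only [map_add, AddCircle.toCircle_add, Circle.coe_mul]
  exact (mul_left_eq_self₀.1 invariance).resolve_left hne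

theorem addSubgroup_eq_top_of_separatesPoints {S : AddSubgroup (K →ₜ+ UnitAddCircle)}
    (hS : ∀ x ≠ 0, ∃ ψ ∈ S, ψ x ≠ 0) : S = ⊤ := by
  borelize K
  let μ : Measure K := Measure.addHaar
  refine (AddSubgroup.eq_top_iff' S).2 fun ψ => ?_
  by_contra hψ
  let fourierCoeffOf : C(K, ℂ) →L[ℂ] ℂ :=
    (integralFunctional μ).comp (ContinuousLinearMap.mul ℂ C(K, ℂ) (characterFun K (.ofAdd (-ψ))))
  have hcoeff (χ : K →ₜ+ UnitAddCircle) : fourierCoeffOf (characterFun K (.ofAdd χ)) =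
      integralFunctional μ (characterFun K (.ofAdd (-ψ + χ))) := by
    rw [ofAdd_add, map_mul]; rfl
  have hzero : fourierCoeffOf = 0 := by
    refine ContinuousLinearMap.ext_on (dense_span_characterFun hS) ?_
    rintro _ ⟨χ, hχ, rfl⟩
    refine (hcoeff χ).trans (integralFunctional_characterFun_eq_zero μ fun h => hψ ?_)
    rwa [neg_add_eq_zero.1 h]
  have hone : fourierCoeffOf (characterFun K (.ofAdd ψ)) = integralFunctional μ 1 := by
    rw [hcoeff, neg_add_cancel, ofAdd_zero, map_one]
  exact integralFunctional_one_ne_zero μ (hone.symm.trans (by rw [hzero]; rfl))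

end Orthogonality

section Duality

variable {K : Type*} [AddCommGroup K] [TopologicalSpace K] [IsTopologicalAddGroup K]
  [CompactSpace K]

theorem exists_character_separating_of_isClosed {H : AddSubgroup K} (hH : IsClosed (H : Set K))
    {y : K} (hy : y ∉ H) : ∃ ψ : K →ₜ+ UnitAddCircle, (∀ h ∈ H, ψ h = 0) ∧ ψ y ≠ 0 := by
  have : IsClosed (H : Set K) := hH
  obtain ⟨ψ, hψ⟩ := exists_character_ne_zero (mt (QuotientAddGroup.eq_zero_iff y).1 hy)
  refine ⟨ψ.comp ⟨QuotientAddGroup.mk' H, continuous_quotient_mk'⟩, fun h hh => ?_, hψ⟩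
  change ψ (QuotientAddGroup.mk h) = 0
  rw [(QuotientAddGroup.eq_zero_iff h).2 hh, map_zero]

/-- The values of characters at `x`, as a homomorphism on the group of characters. -/
def evalAt {M : Type*} [AddCommGroup M] [TopologicalSpace M] (x : M) :
    (M →ₜ+ UnitAddCircle) →+ UnitAddCircle :=
  AddMonoidHom.mk' (fun χ => χ x) fun _ _ => rfl

/-- The homomorphism to a power of the circle whose coordinates are the given characters. -/
def evalCharacters {ι M : Type*} [AddCommGroup M] [TopologicalSpace M]
    (v : ι → (M →ₜ+ UnitAddCircle)) : M →+ (ι → UnitAddCircle) :=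
  AddMonoidHom.pi fun i => (v i).toAddMonoidHom

theorem continuous_evalCharacters {ι M : Type*} [AddCommGroup M] [TopologicalSpace M]
    (v : ι → (M →ₜ+ UnitAddCircle)) : Continuous (evalCharacters v) :=
  continuous_pi fun i => (v i).continuous_toFun

/-- A point of the group `(K →ₜ+ 𝕋) → 𝕋` outside the closed image of `K` is separated from it by
a character of that group, and on homomorphisms such a character is evaluation at an element of
`K →ₜ+ 𝕋`, which then vanishes on `K`. -/
theorem exists_eval_eq {K : Type*} [AddCommGroup K] [TopologicalSpace K] [CompactSpace K]
    (v : (K →ₜ+ UnitAddCircle) →+ UnitAddCircle) :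
    ∃ x, ∀ χ, χ x = v χ := by
  let e : K →+ ((K →ₜ+ UnitAddCircle) → UnitAddCircle) := evalCharacters id
  suffices hv : (v : (K →ₜ+ UnitAddCircle) → UnitAddCircle) ∈ e.range by
    obtain ⟨x, hx⟩ := hv
    exact ⟨x, congrFun hx⟩
  have hclosed : IsClosed (e.range : Set ((K →ₜ+ UnitAddCircle) → UnitAddCircle)) := by
    rw [AddMonoidHom.coe_range]
    exact (isCompact_range (continuous_evalCharacters id)).isClosed
  by_contra hv
  obtain ⟨ψ, hψK, hψv⟩ := exists_character_separating_of_isClosed hclosed hv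
  let S : AddSubgroup (((K →ₜ+ UnitAddCircle) → UnitAddCircle) →ₜ+ UnitAddCircle) :=
    { carrier := {ψ | ∃ a, ∀ w : (K →ₜ+ UnitAddCircle) →+ UnitAddCircle, ψ w = w a}
      zero_mem' := ⟨0, fun w => (map_zero w).symm⟩
      add_mem' := by
        rintro ψ ψ' ⟨a, ha⟩ ⟨a', ha'⟩
        exact ⟨a + a', fun w => by rw [map_add, ← ha, ← ha']; rfl⟩
      neg_mem' := by
        rintro ψ ⟨a, ha⟩
        exact ⟨-a, fun w => by rw [map_neg, ← ha]; rfl⟩ }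
  have hS : S = ⊤ := addSubgroup_eq_top_of_separatesPoints fun w hw => by
    obtain ⟨χ, hχ⟩ := Function.ne_iff.1 hw
    exact ⟨⟨Pi.evalAddMonoidHom _ χ, continuous_apply χ⟩, ⟨χ, fun w => rfl⟩, hχ⟩
  obtain ⟨a, ha⟩ : ψ ∈ S := hS ▸ AddSubgroup.mem_top ψ
  have ha0 : a = 0 := ContinuousAddMonoidHom.ext fun x =>
    (ha (evalAt x)).symm.trans (hψK _ ⟨x, rfl⟩)
  exact hψv (by rw [ha, ha0, map_zero])

variable [T2Space K]

theorem isInducing_evalCharacters :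
    IsInducing (evalCharacters (id : (K →ₜ+ UnitAddCircle) → (K →ₜ+ UnitAddCircle))) :=
  ((continuous_evalCharacters id).isClosedEmbedding fun _ _ h =>
    eq_of_forall_character (congrFun h)).isInducing

theorem exists_finset_characters {V : Set K} (hV : V ∈ 𝓝 (0 : K)) :
    ∃ F : Finset (K →ₜ+ UnitAddCircle), ∀ x, (∀ χ ∈ F, χ x = 0) → x ∈ V := by
  rw [isInducing_evalCharacters.nhds_eq_comap, map_zero, nhds_pi] at hV
  obtain ⟨W, hW, hWV⟩ := hV
  obtain ⟨I, hI, t, ht, htW⟩ := Filter.mem_pi.1 hW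
  refine ⟨hI.toFinset, fun x hx => hWV (htW fun χ hχ => ?_)⟩
  rw [show evalCharacters id x χ = 0 from hx χ (hI.mem_toFinset.2 hχ)]
  exact mem_of_mem_nhds (ht χ)

end Duality

section Divisible

variable {A D : Type*} [AddCommGroup A] [AddCommGroup D] [DivisibleBy D ℤ]

theorem exists_hom_of_linearIndependent {ι : Type*} {v : ι → A} (hv : LinearIndependent ℤ v)
    (g : ι → D) : ∃ h : A →+ D, ∀ i, h (v i) = g i := by
  obtain ⟨h, hh⟩ := (Module.Baer.of_divisible D).extension_property
    (Finsupp.linearCombination ℤ v) hv (Finsupp.linearCombination ℤ g)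
  exact ⟨h.toAddMonoidHom, fun i => by simpa using LinearMap.congr_fun hh (Finsupp.single i 1)⟩

theorem exists_hom_apply_eq (a : A) (d : D) (had : ∀ n : ℤ, n • a = 0 → n • d = 0) :
    ∃ h : A →+ D, h a = d := by
  let fa := LinearMap.toSpanSingleton ℤ A a
  let fd := LinearMap.toSpanSingleton ℤ D d
  have hker : LinearMap.ker fa ≤ LinearMap.ker fd := fun n hn => had n hn
  obtain ⟨h, hh⟩ := (Module.Baer.of_divisible D).extension_property
    ((LinearMap.ker fa).liftQ fa le_rfl)
    (LinearMap.ker_eq_bot.1 (Submodule.ker_liftQ_eq_bot _ _ _ le_rfl))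
    ((LinearMap.ker fa).liftQ fd hker)
  have hh1 := LinearMap.congr_fun hh (Submodule.Quotient.mk 1)
  rw [LinearMap.comp_apply, Submodule.liftQ_apply, Submodule.liftQ_apply] at hh1
  exact ⟨h.toAddMonoidHom, by simpa [fa, fd] using hh1⟩

theorem zsmul_surjective_primaryComponent (D : Type*) [AddCommGroup D] [DivisibleBy D ℤ] (p : ℕ)
    [hp : Fact p.Prime] {m : ℤ} (hm : m ≠ 0) :
    Function.Surjective fun t : AddCommGroup.primaryComponent D p => m • t := by
  rintro ⟨t, n, hn⟩
  obtain ⟨m', hm', hdvd⟩ := (Int.finiteMultiplicity_iff.2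
    ⟨by simpa using hp.out.ne_one, hm⟩ : FiniteMultiplicity (p : ℤ) m).exists_eq_pow_mul_and_not_dvd
  set k := multiplicity (p : ℤ) m
  obtain ⟨a, b, hab⟩ : IsCoprime ((p : ℤ) ^ (k + n)) m' :=
    ((Nat.prime_iff_prime_int.1 hp.out).coprime_iff_not_dvd.2 hdvd).pow_left
  obtain ⟨s, rfl⟩ : ∃ s : D, m • s = t := DivisibleBy.surjective_smul D ℤ hm t
  have hn' : (p : ℤ) ^ n • m • s = 0 := by exact_mod_cast hn
  refine ⟨⟨(b * m') • s, k + n, ?_⟩, Subtype.ext ?_⟩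
  · rw [← natCast_zsmul, ← mul_smul]
    calc (((p ^ (k + n) : ℕ) : ℤ) * (b * m')) • s = b • (p : ℤ) ^ n • m • s := by
          rw [← mul_smul, ← mul_smul]
          congr 1
          push_cast
          linear_combination -(b * (p : ℤ) ^ n) * hm'
      _ = 0 := by rw [hn', smul_zero]
  · change m • (b * m') • s = m • s
    calc m • (b * m') • s = m • s - (a * (p : ℤ) ^ k) • (p : ℤ) ^ n • m • s := by
          rw [← mul_smul, ← mul_smul, ← mul_smul, ← sub_smul]
          congr 1
          linear_combination m * hab
      _ = m • s := by rw [hn', smul_zero, sub_zero]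

noncomputable instance (p : ℕ) [Fact p.Prime] :
    DivisibleBy (AddCommGroup.primaryComponent D p) ℤ :=
  divisibleByOfSMulRightSurj _ _ fun hm => zsmul_surjective_primaryComponent D p hm

end Divisible

section PadicInt

variable {K : Type*} [AddCommGroup K] [TopologicalSpace K] [IsTopologicalAddGroup K]
  [CompactSpace K] [T2Space K]

/-- A non-trivial character `a` has order divisible by some prime `p` (all primes divide the order
`0`), so it is sent to an element of order `p` by some homomorphism `h` to the quasicyclic group
`ℤ(p^∞)`; the point of `K` whose evaluation is `h` has the required property. -/
theorem exists_ne_zero_forall_character_mem_primaryComponent [Nontrivial K] :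
    ∃ p : ℕ, p.Prime ∧ ∃ x : K, x ≠ 0 ∧
      ∀ χ : K →ₜ+ UnitAddCircle, χ x ∈ AddCommGroup.primaryComponent UnitAddCircle p := by
  obtain ⟨y, hy⟩ := exists_ne (0 : K)
  obtain ⟨a, ha⟩ := exists_character_ne_zero hy
  have ha0 : a ≠ 0 := fun h => ha (by rw [h]; rfl)
  obtain ⟨p, hp, hpa⟩ : ∃ p : ℕ, p.Prime ∧ p ∣ addOrderOf a :=
    Nat.exists_prime_and_dvd fun h => ha0 (AddMonoid.addOrderOf_eq_one_iff.1 h)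
  have := Fact.mk hp
  let t : UnitAddCircle := ((1 / p : ℝ) : UnitAddCircle)
  have ht : addOrderOf t = p := AddCircle.addOrderOf_period_div hp.pos
  have htp : t ∈ AddCommGroup.primaryComponent UnitAddCircle p :=
    AddCommGroup.mem_primaryComponent_iff_addOrderOf.2 ⟨1, by rw [ht, pow_one]⟩
  obtain ⟨h, hh⟩ := exists_hom_apply_eq a (⟨t, htp⟩ : AddCommGroup.primaryComponent UnitAddCircle p)
    fun n hn => Subtype.ext (addOrderOf_dvd_iff_zsmul_eq_zero.1 (ht.symm ▸
      (Int.natCast_dvd_natCast.2 hpa).trans (addOrderOf_dvd_iff_zsmul_eq_zero.2 hn)))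
  obtain ⟨x, hx⟩ := exists_eval_eq ((AddSubgroup.subtype _).comp h)
  refine ⟨p, hp, x, ?_, fun χ => hx χ ▸ (h χ).2⟩
  rintro rfl
  have ht0 : t = 0 := by
    have := hx a
    rw [map_zero, AddMonoidHom.comp_apply, hh] at this
    exact this.symm
  exact hp.ne_one (by rw [← ht, ht0, addOrderOf_zero])

theorem eq_zero_of_mem_closure_zmultiples_one {p : ℕ} [hp : Fact p.Prime] {x : K}
    (hx : ∀ χ : K →ₜ+ UnitAddCircle, χ x ∈ AddCommGroup.primaryComponent UnitAddCircle p) {y : K}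
    (hy : ((0 : ℤ_[p]), y) ∈ closure (AddSubgroup.zmultiples ((1 : ℤ_[p]), x) : Set (ℤ_[p] × K))) :
    y = 0 := by
  refine eq_of_forall_character fun χ => ?_
  rw [map_zero]
  obtain ⟨N, hN⟩ := hx χ
  have hclosed : IsClosed {w : ℤ_[p] × K | ‖w.1‖ < (p : ℝ) ^ (-N + 1 : ℤ) → χ w.2 = 0} := by
    simp only [imp_iff_not_or, Set.ofPred_or]
    exact (isOpen_lt (continuous_norm.comp continuous_fst) continuous_const).isClosed_compl.union
      (isClosed_eq (χ.continuous_toFun.comp continuous_snd) continuous_const)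
  have hpos : ‖(0 : ℤ_[p])‖ < (p : ℝ) ^ (-N + 1 : ℤ) := by
    rw [norm_zero]
    exact zpow_pos (mod_cast hp.out.pos) _
  refine hclosed.closure_subset_iff.2 ?_ hy hpos
  rintro _ ⟨n, rfl⟩ hn
  obtain ⟨m, rfl⟩ : (p : ℤ) ^ N ∣ n := by
    rw [← PadicInt.norm_int_le_pow_iff_dvd, PadicInt.norm_le_pow_iff_norm_lt_pow_add_one]
    simpa using hn
  change χ (((p : ℤ) ^ N * m) • x) = 0
  have hN' : (p : ℤ) ^ N • χ x = 0 := by exact_mod_cast hN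
  rw [map_zsmul, mul_comm, mul_smul, hN', smul_zero]

/-- The closure of the subgroup generated by `(1, x)` is the graph of the required homomorphism. -/
theorem exists_padicInt_hom (p : ℕ) [Fact p.Prime] (x : K)
    (hx : ∀ χ : K →ₜ+ UnitAddCircle, χ x ∈ AddCommGroup.primaryComponent UnitAddCircle p) :
    ∃ Φ : ℤ_[p] →ₜ+ K, Φ 1 = x := by
  let Γ : AddSubgroup (ℤ_[p] × K) :=
    (AddSubgroup.zmultiples ((1 : ℤ_[p]), x)).topologicalClosure
  have : CompactSpace Γ :=
    isCompact_iff_compactSpace.1 (AddSubgroup.isClosed_topologicalClosure _).isCompact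
  have hmem (n : ℤ) : n • ((1 : ℤ_[p]), x) ∈ Γ :=
    AddSubgroup.le_topologicalClosure _ (AddSubgroup.zsmul_mem_zmultiples _ n)
  let π : Γ →+ ℤ_[p] := (AddMonoidHom.fst ℤ_[p] K).comp Γ.subtype
  have hπ : Continuous π := continuous_fst.comp continuous_subtype_val
  have hinj : Function.Injective π := by
    refine (injective_iff_map_eq_zero π).2 ?_
    rintro ⟨⟨_, y⟩, hy⟩ rfl
    exact Subtype.ext (Prod.ext rfl (eq_zero_of_mem_closure_zmultiples_one hx hy))
  have hsurj : Function.Surjective π := by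
    refine Set.range_eq_univ.1 ((isCompact_range hπ).isClosed.closure_eq.symm.trans
      (Dense.closure_eq (PadicInt.denseRange_intCast.mono ?_)))
    rintro _ ⟨n, rfl⟩
    exact ⟨⟨_, hmem n⟩, zsmul_one n⟩
  let e : Γ ≃+ ℤ_[p] := AddEquiv.ofBijective π ⟨hinj, hsurj⟩
  have he : Continuous e.symm :=
    Continuous.continuous_symm_of_equiv_compact_to_t2 (f := e.toEquiv) hπ
  have he1 : e.symm 1 = ⟨_, hmem 1⟩ := e.symm_apply_eq.2 (one_smul ℤ (1 : ℤ_[p])).symm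
  refine ⟨⟨((AddMonoidHom.snd ℤ_[p] K).comp Γ.subtype).comp e.symm.toAddMonoidHom,
    continuous_snd.comp (continuous_subtype_val.comp he)⟩, ?_⟩
  change (e.symm 1 : ℤ_[p] × K).2 = x
  rw [he1]
  exact one_smul ℤ x

theorem exists_pow_nsmul_map_one_eq_zero {M : Type*} [AddCommGroup M] [TopologicalSpace M]
    [T1Space M] {p : ℕ} [Fact p.Prime] {Φ : ℤ_[p] →ₜ+ M} (hΦ : ¬ Function.Injective Φ) :
    ∃ k : ℕ, p ^ k • Φ 1 = 0 := by
  obtain ⟨z, hz, hz0⟩ : ∃ z, Φ z = 0 ∧ z ≠ 0 := by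
    simpa [injective_iff_map_eq_zero] using hΦ
  have map_mul_eq_zero (w : ℤ_[p]) : Φ (w * z) = 0 := by
    refine PadicInt.denseRange_intCast.induction_on (p := fun w => Φ (w * z) = 0) w
      (isClosed_singleton.preimage (Φ.continuous_toFun.comp (continuous_mul_const z))) fun n => ?_
    rw [← zsmul_eq_mul, map_zsmul, hz, smul_zero]
  refine ⟨z.valuation, ?_⟩
  have hunit : ((PadicInt.unitCoeff hz0)⁻¹ : ℤ_[p]ˣ) * z = (p ^ z.valuation : ℕ) := by
    rw [Units.inv_mul_eq_iff_eq_mul, Nat.cast_pow]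
    exact PadicInt.unitCoeff_spec hz0
  rw [← map_nsmul, nsmul_one, ← hunit, map_mul_eq_zero]

theorem exists_ne_zero_nsmul_eq_zero {M : Type*} [AddMonoid M] {p k : ℕ} {x : M} (hx : x ≠ 0)
    (hk : p ^ k • x = 0) : ∃ y : M, y ≠ 0 ∧ p • y = 0 := by
  induction k with
  | zero => exact absurd (by simpa using hk) hx
  | succ k ih =>
    by_cases h : p ^ k • x = 0
    · exact ih h
    · exact ⟨p ^ k • x, h, by rwa [← mul_smul, ← pow_succ']⟩

end PadicInt

section Monothetic

theorem isPMonothetic_of_equiv (p : ℕ) [Fact p.Prime] {A B : Type*} [AddCommGroup A]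
    [TopologicalSpace A] [AddCommGroup B] [TopologicalSpace B] (e : A ≃ₜ+ B)
    (h : IsPMonothetic p A) : IsPMonothetic p B := by
  obtain ⟨⟨a, ha⟩, h⟩ := h
  refine ⟨⟨e a, ?_⟩, h.imp ?_ ?_⟩
  · refine (e.surjective.denseRange.dense_image e.continuous ha).mono ?_
    rintro _ ⟨_, ⟨n, rfl⟩, rfl⟩
    exact ⟨n, (map_zsmul e n a).symm⟩
  · rintro ⟨hc, k, hk⟩
    exact ⟨isAddCyclic_of_surjective e.toAddEquiv e.toAddEquiv.surjective, k,
      (Nat.card_congr e.toEquiv).symm.trans hk⟩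
  · rintro ⟨H, ⟨f⟩⟩
    exact ⟨H, ⟨e.symm.trans f⟩⟩

theorem isPMonothetic_top_padicInt (p : ℕ) [Fact p.Prime] :
    IsPMonothetic p (⊤ : AddSubgroup ℤ_[p]) := by
  refine ⟨⟨⟨1, trivial⟩, Subtype.dense_iff.2 fun z _ =>
    closure_mono ?_ (PadicInt.denseRange_intCast z)⟩, Or.inr ⟨⊤, ⟨ContinuousAddEquiv.refl _⟩⟩⟩
  rintro _ ⟨n, rfl⟩
  exact ⟨_, ⟨n, rfl⟩, zsmul_one n⟩

/-- The isomorphism of a closed subgroup of a compact group onto its image under a continuous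
injective homomorphism to a Hausdorff group. -/
noncomputable def equivMapOfInjective {L M : Type*} [AddCommGroup L] [TopologicalSpace L]
    [CompactSpace L] [AddCommGroup M] [TopologicalSpace M] [T2Space M] (f : L →+ M)
    (hf : Continuous f) (hi : Function.Injective f) (C : AddSubgroup L)
    (hC : IsClosed (C : Set L)) : C ≃ₜ+ C.map f :=
  have : CompactSpace C := isCompact_iff_compactSpace.1 hC.isCompact
  have hc : Continuous (C.equivMapOfInjective f hi) :=
    Continuous.subtype_mk (hf.comp continuous_subtype_val) _
  { C.equivMapOfInjective f hi with
    continuous_toFun := hc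
    continuous_invFun := hc.continuous_symm_of_equiv_compact_to_t2 }

theorem isWeaklyEssential_comap {L M : Type*} [AddCommGroup L] [TopologicalSpace L]
    [CompactSpace L] [AddCommGroup M] [TopologicalSpace M] [T2Space M] {f : L →+ M}
    (hf : Continuous f) (hi : Function.Injective f) {G : AddSubgroup M}
    (hG : G.IsWeaklyEssential) : (G.comap f).IsWeaklyEssential := by
  intro p _ C hC hinf hmon hbot
  refine hG p (C.map f) ?_ ?_ (isPMonothetic_of_equiv p (equivMapOfInjective f hf hi C hC) hmon) ?_
  · rw [AddSubgroup.coe_map]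
    exact (hC.isCompact.image hf).isClosed
  · rw [AddSubgroup.coe_map]
    exact hinf.image hi.injOn
  · rw [AddSubgroup.eq_bot_iff_forall] at hbot ⊢
    rintro _ ⟨hxG, x, hx, rfl⟩
    rw [hbot x ⟨hxG, hx⟩, map_zero]

theorem exists_ne_zero_map_mem_of_isWeaklyEssential {M : Type*} [AddCommGroup M]
    [TopologicalSpace M] [T2Space M] {G : AddSubgroup M} (hG : G.IsWeaklyEssential) {p : ℕ}
    [Fact p.Prime] {Φ : ℤ_[p] →ₜ+ M} (hΦ : Function.Injective Φ) : ∃ z ≠ 0, Φ z ∈ G := by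
  have hne := isWeaklyEssential_comap (f := Φ.toAddMonoidHom) Φ.continuous_toFun hΦ hG p ⊤
    isClosed_univ Set.infinite_univ (isPMonothetic_top_padicInt p)
  obtain ⟨⟨z, hz⟩, hz0⟩ := AddSubgroup.ne_bot_iff_exists_ne_zero.1 hne
  exact ⟨z, fun h => hz0 (Subtype.ext h), hz.1⟩

theorem exists_prime_order_or_injective_padicInt_hom (K : Type*) [AddCommGroup K]
    [TopologicalSpace K] [IsTopologicalAddGroup K] [CompactSpace K] [T2Space K] [Nontrivial K] :
    (∃ p : ℕ, p.Prime ∧ ∃ y : K, y ≠ 0 ∧ p • y = 0) ∨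
      ∃ (p : ℕ) (_ : Fact p.Prime) (Φ : ℤ_[p] →ₜ+ K), Function.Injective Φ := by
  obtain ⟨p, hp, x, hx0, hx⟩ := exists_ne_zero_forall_character_mem_primaryComponent (K := K)
  have := Fact.mk hp
  obtain ⟨Φ, rfl⟩ := exists_padicInt_hom p x hx
  by_cases hΦ : Function.Injective Φ
  · exact Or.inr ⟨p, this, Φ, hΦ⟩
  · obtain ⟨k, hk⟩ := exists_pow_nsmul_map_one_eq_zero hΦ
    exact Or.inl ⟨p, hp, exists_ne_zero_nsmul_eq_zero hx0 hk⟩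

end Monothetic

theorem mem_torsionBy_iff_nsmul {A : Type*} [AddCommGroup A] {p : ℕ} {x : A} :
    x ∈ AddSubgroup.torsionBy A (p : ℤ) ↔ p • x = 0 := by
  rw [← natCast_zsmul]
  exact Submodule.mem_torsionBy_iff _ _

theorem mem_of_isCoprime_zsmul_mem {A : Type*} [AddCommGroup A] {H : AddSubgroup A} {m n : ℤ}
    (hmn : IsCoprime m n) {x : A} (hm : m • x ∈ H) (hn : n • x ∈ H) : x ∈ H := by
  obtain ⟨a, b, hab⟩ := hmn
  rw [← one_smul ℤ x, ← hab, add_smul, mul_smul, mul_smul]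
  exact H.add_mem (H.zsmul_mem hm a) (H.zsmul_mem hn b)

section SmallSubgroups

theorem norm_two_nsmul_of_norm_lt {t : UnitAddCircle} (ht : ‖t‖ < 1 / 4) :
    ‖2 • t‖ = 2 * ‖t‖ := by
  obtain ⟨x, rfl⟩ := QuotientAddGroup.mk_surjective t
  rw [UnitAddCircle.norm_eq] at ht
  have hround : round (2 * x) = 2 * round x := by
    have habs := abs_lt.1 ht
    rw [show 2 * x = 2 * (x - round x) + ((2 * round x : ℤ) : ℝ) by push_cast; ring,
      round_add_intCast, round_eq_zero_iff.2 ⟨by linarith, by linarith⟩, zero_add]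
  change ‖((2 • x : ℝ) : UnitAddCircle)‖ = 2 * ‖(x : UnitAddCircle)‖
  rw [two_nsmul, ← two_mul, UnitAddCircle.norm_eq, UnitAddCircle.norm_eq, hround, Int.cast_mul,
    Int.cast_ofNat, ← mul_sub, abs_mul, abs_two]

theorem eq_zero_of_forall_norm_nsmul_lt {t : UnitAddCircle} (h : ∀ n : ℕ, ‖n • t‖ < 1 / 4) :
    t = 0 := by
  have norm_pow_nsmul (n : ℕ) : ‖2 ^ n • t‖ = 2 ^ n * ‖t‖ := by
    induction n with
    | zero => simp
    | succ n ih =>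
      rw [pow_succ', mul_smul, norm_two_nsmul_of_norm_lt (h _), ih, pow_succ', mul_assoc]
  by_contra ht
  obtain ⟨n, hn⟩ := pow_unbounded_of_one_lt (1 / 4 / ‖t‖) one_lt_two
  rw [div_lt_iff₀ (norm_pos_iff.2 ht), ← norm_pow_nsmul] at hn
  exact lt_asymm hn (h _)

theorem exists_addSubgroup_forall_nsmul_mem {L : Type*} [AddCommGroup L] [TopologicalSpace L]
    [IsTopologicalAddGroup L] [CompactSpace L] [TotallyDisconnectedSpace L] {U : Set L}
    (hU : U ∈ 𝓝 (0 : L)) :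
    ∃ (H : AddSubgroup L) (d : ℕ), d ≠ 0 ∧ (H : Set L) ⊆ U ∧ ∀ x, d • x ∈ H := by
  obtain ⟨W, hWU, hW, h0⟩ := mem_nhds_iff.1 hU
  obtain ⟨H, hH⟩ := ProfiniteGrp.exist_openNormalAddSubgroup_sub_open_nhds_of_zero hW h0
  have : H.toAddSubgroup.FiniteIndex :=
    AddSubgroup.finiteIndex_of_finite_quotient (H := H.toAddSubgroup)
  exact ⟨H.toAddSubgroup, H.toAddSubgroup.index, AddSubgroup.FiniteIndex.index_ne_zero,
    hH.trans hWU, fun x => AddSubgroup.nsmul_index_mem _ x⟩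

theorem exists_nsmul_character_eq_zero {L : Type*} [AddCommGroup L] [TopologicalSpace L]
    [IsTopologicalAddGroup L] [CompactSpace L] [TotallyDisconnectedSpace L]
    (χ : L →ₜ+ UnitAddCircle) : ∃ d : ℕ, d ≠ 0 ∧ ∀ x, d • χ x = 0 := by
  have hball : χ ⁻¹' Metric.ball 0 (1 / 4) ∈ 𝓝 (0 : L) :=
    χ.continuous_toFun.continuousAt.preimage_mem_nhds (by
      change _ ∈ 𝓝 (χ 0)
      rw [map_zero]
      exact Metric.ball_mem_nhds _ (by norm_num))
  obtain ⟨H, d, hd0, hHU, hHd⟩ := exists_addSubgroup_forall_nsmul_mem hball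
  refine ⟨d, hd0, fun x => eq_zero_of_forall_norm_nsmul_lt fun n => ?_⟩
  rw [← map_nsmul, ← map_nsmul]
  exact mem_ball_zero_iff.1 (hHU (H.nsmul_mem (hHd x) n))

end SmallSubgroups

section ContainsSmallPrimeTorsion

/-- The group `G` contains all elements of prime order that generate sufficiently small subgroups.
For weakly essential subgroups of compact groups this is a reformulation of local essentiality; it
is better behaved with respect to subgroups and quotients. -/
def ContainsSmallPrimeTorsion {M : Type*} [AddCommGroup M] [TopologicalSpace M]
    (G : AddSubgroup M) : Prop :=
  ∃ V ∈ 𝓝 (0 : M), ∀ p : ℕ, p.Prime → ∀ x : M, p • x = 0 →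
    (AddSubgroup.zmultiples x : Set M) ⊆ V → x ∈ G

variable {M : Type*} [AddCommGroup M] [TopologicalSpace M] {G : AddSubgroup M}

theorem mem_of_inf_zmultiples_ne_bot {A : Type*} [AddCommGroup A] {G : AddSubgroup A} {p : ℕ}
    (hp : p.Prime) {x : A} (hx : p • x = 0) (h : G ⊓ AddSubgroup.zmultiples x ≠ ⊥) : x ∈ G := by
  obtain ⟨⟨_, hG, k, rfl⟩, hk⟩ := AddSubgroup.ne_bot_iff_exists_ne_zero.1 h
  have hx' : (p : ℤ) • x = 0 := by rwa [natCast_zsmul]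
  have hpk : ¬ (p : ℤ) ∣ k := by
    rintro ⟨c, rfl⟩
    refine hk (Subtype.ext ?_)
    change ((p : ℤ) * c) • x = 0
    rw [mul_comm, mul_smul, hx', smul_zero]
  exact mem_of_isCoprime_zsmul_mem ((Nat.prime_iff_prime_int.1 hp).coprime_iff_not_dvd.2 hpk)
    (hx' ▸ G.zero_mem) hG

theorem containsSmallPrimeTorsion_of_isLocallyEssential [T1Space M] (hG : G.IsLocallyEssential) :
    ContainsSmallPrimeTorsion G := by
  obtain ⟨V, hV, h⟩ := hG
  refine ⟨V, hV, fun p hp x hx hxV => ?_⟩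
  rcases eq_or_ne x 0 with rfl | hx0
  · exact G.zero_mem
  have hfinite : (AddSubgroup.zmultiples x : Set M).Finite :=
    finite_zmultiples.2 (isOfFinAddOrder_iff_nsmul_eq_zero.2 ⟨p, hp.pos, hx⟩)
  exact mem_of_inf_zmultiples_ne_bot hp hx
    (h _ hfinite.isClosed (by rwa [ne_eq, AddSubgroup.zmultiples_eq_bot]) hxV)

/-- A closed subgroup contains elements of prime order, which lie in `G` when they are small, or a
copy of the `p`-adic integers, which meets `G` by weak essentiality. -/
theorem isLocallyEssential_of_containsSmallPrimeTorsion [IsTopologicalAddGroup M] [CompactSpace M]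
    [T2Space M] (hG : G.IsWeaklyEssential) (h : ContainsSmallPrimeTorsion G) :
    G.IsLocallyEssential := by
  obtain ⟨V, hV, h⟩ := h
  refine ⟨V, hV, fun S hS hS0 hSV => ?_⟩
  have : CompactSpace S := isCompact_iff_compactSpace.1 hS.isCompact
  have : Nontrivial S := (AddSubgroup.nontrivial_iff_ne_bot S).2 hS0
  suffices hmeet : ∃ y : S, y ≠ 0 ∧ (y : M) ∈ G by
    obtain ⟨y, hy0, hyG⟩ := hmeet
    exact AddSubgroup.ne_bot_iff_exists_ne_zero.2
      ⟨(⟨y, hyG, y.2⟩ : ↥(G ⊓ S)), fun h0 => hy0 (Subtype.ext (congrArg (G ⊓ S).subtype h0))⟩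
  rcases exists_prime_order_or_injective_padicInt_hom S with ⟨p, hp, y, hy0, hy⟩ | ⟨p, _, Φ, hΦ⟩
  · exact ⟨y, hy0, h p hp y (congrArg Subtype.val hy)
      (subset_trans (AddSubgroup.zmultiples_le.2 y.2) hSV)⟩
  · have hGS : (G.comap S.subtype).IsWeaklyEssential :=
      isWeaklyEssential_comap continuous_subtype_val Subtype.val_injective hG
    obtain ⟨z, hz0, hz⟩ := exists_ne_zero_map_mem_of_isWeaklyEssential hGS hΦ
    exact ⟨Φ z, (map_ne_zero_iff Φ hΦ).2 hz0, hz⟩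

theorem containsSmallPrimeTorsion_of_comap {L : Type*} [AddCommGroup L] [TopologicalSpace L]
    {f : L →+ M} (hf : IsEmbedding f) (hrange : ContainsSmallPrimeTorsion f.range)
    (hcomap : ContainsSmallPrimeTorsion (G.comap f)) : ContainsSmallPrimeTorsion G := by
  obtain ⟨V, hV, hVf⟩ := hrange
  obtain ⟨W, hW, hWG⟩ := hcomap
  rw [hf.nhds_eq_comap, map_zero] at hW
  obtain ⟨W', hW', hWW'⟩ := hW
  refine ⟨V ∩ W', inter_mem hV hW', fun p hp x hx hxV => ?_⟩
  obtain ⟨y, rfl⟩ := hVf p hp x hx (hxV.trans Set.inter_subset_left)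
  refine hWG p hp y (hf.injective (by rw [map_nsmul, hx, map_zero])) ?_
  rintro _ ⟨k, rfl⟩
  exact hWW' (hxV ⟨k, (map_zsmul f k y).symm⟩).2

/-- The circle group has no small subgroups. -/
theorem containsSmallPrimeTorsion_ker_evalCharacters {ι : Type*} [Finite ι]
    (v : ι → (M →ₜ+ UnitAddCircle)) : ContainsSmallPrimeTorsion (evalCharacters v).ker := by
  refine ⟨⋂ i, v i ⁻¹' Metric.ball 0 (1 / 4), iInter_mem.2 fun i => ?_, fun p _ x _ hx => ?_⟩
  · refine (v i).continuous_toFun.continuousAt.preimage_mem_nhds ?_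
    change _ ∈ 𝓝 (v i 0)
    rw [map_zero]
    exact Metric.ball_mem_nhds _ (by norm_num)
  · refine funext fun i => eq_zero_of_forall_norm_nsmul_lt fun n => ?_
    have hn := Set.mem_iInter.1 (hx (AddSubgroup.nsmul_mem_zmultiples x n)) i
    rwa [Set.mem_preimage, mem_ball_zero_iff, map_nsmul] at hn

theorem exists_finset_ker_inf_torsionBy_le [IsTopologicalAddGroup M] [CompactSpace M] [T2Space M]
    (hG : ContainsSmallPrimeTorsion G) :
    ∃ F : Finset (M →ₜ+ UnitAddCircle), ∀ p : ℕ, p.Prime →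
      ∀ x : M, p • x = 0 → (∀ χ ∈ F, χ x = 0) → x ∈ G := by
  obtain ⟨V, hV, h⟩ := hG
  obtain ⟨F, hF⟩ := exists_finset_characters hV
  refine ⟨F, fun p hp x hx hχ => h p hp x hx ?_⟩
  rintro _ ⟨k, rfl⟩
  exact hF _ fun χ hχF => by simp only [map_zsmul, hχ χ hχF, smul_zero]

theorem exists_nhds_inter_torsionBy_le {p : ℕ}
    (ho : IsOpen (G.pTorsionIn p : Set (AddSubgroup.torsionBy M (p : ℤ)))) :
    ∃ V ∈ 𝓝 (0 : M), ∀ x ∈ V, p • x = 0 → x ∈ G := by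
  have hmem := ho.mem_nhds (G.pTorsionIn p).zero_mem
  rw [nhds_subtype_eq_comap] at hmem
  obtain ⟨V, hV, hVG⟩ := hmem
  exact ⟨V, hV, fun x hxV hx =>
    (hVG (a := ⟨x, mem_torsionBy_iff_nsmul.2 hx⟩) hxV : x ∈ G.pTorsion p).1⟩

theorem containsSmallPrimeTorsion_of_pTorsionOpen (ho : G.PTorsionOpen)
    (hfin : ((⊤ : AddSubgroup M).torsionPrimes G).Finite) : ContainsSmallPrimeTorsion G := by
  choose! V hV hVG using fun p hp => exists_nhds_inter_torsionBy_le (ho p hp)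
  refine ⟨⋂ p ∈ (⊤ : AddSubgroup M).torsionPrimes G, V p,
    (biInter_mem hfin).2 fun p hp => hV p hp.1, fun p hp x hx hxV => ?_⟩
  by_cases hpG : p ∈ (⊤ : AddSubgroup M).torsionPrimes G
  · exact hVG p hp x (Set.mem_iInter₂.1 (hxV (AddSubgroup.mem_zmultiples x)) p hpG) hx
  · by_contra hxG
    exact hpG ⟨hp, fun hle => hxG (hle ⟨trivial, mem_torsionBy_iff_nsmul.2 hx⟩)⟩

theorem finite_torsionPrimes_of_containsSmallPrimeTorsion [IsTopologicalAddGroup M]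
    [CompactSpace M] (hG : ContainsSmallPrimeTorsion G) {N : AddSubgroup M}
    (hN : IsClosed (N : Set M)) (hd : IsTotallyDisconnected (N : Set M)) :
    (N.torsionPrimes G).Finite := by
  obtain ⟨V, hV, h⟩ := hG
  have : CompactSpace N := isCompact_iff_compactSpace.1 hN.isCompact
  have : TotallyDisconnectedSpace N := totallyDisconnectedSpace_subtype_iff.2 hd
  obtain ⟨H, d, hd0, hHV, hHd⟩ := exists_addSubgroup_forall_nsmul_mem (L := N)
    (continuous_subtype_val.continuousAt.preimage_mem_nhds hV)
  refine (Set.finite_Iic d).subset fun p hp => ?_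
  by_contra hpd
  refine hp.2 fun x hx => ?_
  have hxp : p • x = 0 := mem_torsionBy_iff_nsmul.1 hx.2
  have hcop : IsCoprime (p : ℤ) d := by
    rw [Nat.isCoprime_iff_coprime, hp.1.coprime_iff_not_dvd]
    exact Nat.not_dvd_of_pos_of_lt (Nat.pos_of_ne_zero hd0) (not_le.1 hpd)
  have hxH : (⟨x, hx.1⟩ : N) ∈ H := by
    refine mem_of_isCoprime_zsmul_mem hcop ?_ (by rw [natCast_zsmul]; exact hHd _)
    rw [natCast_zsmul, show p • (⟨x, hx.1⟩ : N) = 0 from Subtype.ext hxp]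
    exact H.zero_mem
  refine h p hp.1 x hxp ?_
  rintro _ ⟨k, rfl⟩
  exact hHV (H.zsmul_mem hxH k)

end ContainsSmallPrimeTorsion

section TorsionRank

theorem card_torsionBy_unitAddCircle_le {p : ℕ} (hp : p ≠ 0) :
    Nat.card (AddSubgroup.torsionBy UnitAddCircle (p : ℤ)) ≤ p := by
  have h := AddCircle.card_torsion_le_of_isSMulRegular (1 : ℝ) p hp
    (.of_right_eq_zero_of_smul fun _ => by simp [hp])
  have hset : (AddSubgroup.torsionBy UnitAddCircle (p : ℤ) : Set UnitAddCircle) =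
      {x | p • x = 0} := Set.ext fun _ => mem_torsionBy_iff_nsmul
  change Nat.card (AddSubgroup.torsionBy UnitAddCircle (p : ℤ) : Set UnitAddCircle) ≤ p
  rw [hset, Nat.card_coe_set_eq, Set.ncard_def]
  exact ENat.toNat_le_of_le_natCast h

theorem finite_torsionBy_unitAddCircle {p : ℕ} (hp : p ≠ 0) :
    Finite (AddSubgroup.torsionBy UnitAddCircle (p : ℤ)) :=
  ((AddCircle.finite_torsion 1 (Nat.pos_of_ne_zero hp)).subset fun _ =>
    mem_torsionBy_iff_nsmul.1).to_subtype

theorem pRank_le_of_card_le_pow {A : Type u} [AddCommGroup A] [Finite A] {p n : ℕ}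
    [hp : Fact p.Prime] (h : Nat.card A ≤ p ^ n) : pRank p A ≤ n := by
  let _ : Module (ZMod p) (AddSubgroup.torsionBy A (p : ℤ)) := AddSubgroup.torsionBy.zmodModule
  have : Module.Finite (ZMod p) (AddSubgroup.torsionBy A (p : ℤ)) := Module.Finite.of_finite
  change Module.rank (ZMod p) (AddSubgroup.torsionBy A (p : ℤ)) ≤ n
  rw [← Module.finrank_eq_rank, Nat.cast_le, ← Nat.pow_le_pow_iff_right hp.out.one_lt]
  calc p ^ Module.finrank (ZMod p) (AddSubgroup.torsionBy A (p : ℤ))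
      = Nat.card (AddSubgroup.torsionBy A (p : ℤ)) := by
        rw [Module.natCard_eq_pow_finrank (K := ZMod p), Nat.card_zmod]
    _ ≤ Nat.card A := Nat.card_le_card_of_injective _ Subtype.val_injective
    _ ≤ p ^ n := h

variable {M : Type u} [AddCommGroup M] [TopologicalSpace M]

/-- The restriction of a character to the `p`-torsion, with values in the `p`-torsion of the
circle, which is finite. -/
def torsionCharacter (χ : M →ₜ+ UnitAddCircle) (p : ℕ) :
    AddSubgroup.torsionBy M (p : ℤ) →+ AddSubgroup.torsionBy UnitAddCircle (p : ℤ) :=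
  (χ.toAddMonoidHom.comp (AddSubgroup.subtype _)).codRestrict _ fun x =>
    mem_torsionBy_iff_nsmul.2 <| by
      change p • χ x = 0
      rw [← map_nsmul, mem_torsionBy_iff_nsmul.1 x.2, map_zero]

theorem isOpen_ker_torsionCharacter (χ : M →ₜ+ UnitAddCircle) {p : ℕ} (hp : p ≠ 0) :
    IsOpen ((torsionCharacter χ p).ker : Set (AddSubgroup.torsionBy M (p : ℤ))) := by
  have := finite_torsionBy_unitAddCircle hp
  exact (isOpen_discrete {0}).preimage
    ((χ.continuous_toFun.comp continuous_subtype_val).subtype_mk _)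

theorem index_ker_pi_torsionCharacter (F : Finset (M →ₜ+ UnitAddCircle)) {p : ℕ} (hp : p ≠ 0) :
    (AddMonoidHom.pi fun χ : F => torsionCharacter χ.1 p).ker.index ≠ 0 ∧
      (AddMonoidHom.pi fun χ : F => torsionCharacter χ.1 p).ker.index ≤ p ^ F.card := by
  have := finite_torsionBy_unitAddCircle hp
  rw [AddSubgroup.index_ker]
  refine ⟨Nat.card_pos.ne', ?_⟩
  calc Nat.card (AddMonoidHom.pi fun χ : F => torsionCharacter χ.1 p).range
      ≤ Nat.card (F → AddSubgroup.torsionBy UnitAddCircle (p : ℤ)) :=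
        Nat.card_le_card_of_injective _ Subtype.val_injective
    _ = Nat.card (AddSubgroup.torsionBy UnitAddCircle (p : ℤ)) ^ F.card := by
        rw [Nat.card_fun, Nat.card_eq_fintype_card (α := F), Fintype.card_coe]
    _ ≤ p ^ F.card := Nat.pow_le_pow_left (card_torsionBy_unitAddCircle_le hp) _

variable [IsTopologicalAddGroup M] [CompactSpace M] [T2Space M] {G : AddSubgroup M}

theorem pTorsionOpen_of_containsSmallPrimeTorsion (hG : ContainsSmallPrimeTorsion G) :
    G.PTorsionOpen := by
  intro p hp
  obtain ⟨F, hF⟩ := exists_finset_ker_inf_torsionBy_le hG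
  refine AddSubgroup.isOpen_of_mem_nhds _ (g := 0) (mem_of_superset
    ((biInter_finset_mem F).2 fun χ _ => (isOpen_ker_torsionCharacter χ hp.ne_zero).mem_nhds
      (torsionCharacter χ p).ker.zero_mem) fun x hx => ?_)
  exact ⟨hF p hp x (mem_torsionBy_iff_nsmul.1 x.2) fun χ hχ =>
    congrArg Subtype.val (Set.mem_iInter₂.1 hx χ hχ), x.2⟩

theorem exists_pRank_le_of_containsSmallPrimeTorsion (hG : ContainsSmallPrimeTorsion G) :
    ∃ n : ℕ, ∀ p : ℕ, p.Prime →
      pRank p (AddSubgroup.torsionBy M (p : ℤ) ⧸ G.pTorsionIn p) ≤ (n : Cardinal.{u}) := by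
  obtain ⟨F, hF⟩ := exists_finset_ker_inf_torsionBy_le hG
  refine ⟨F.card, fun p hp => ?_⟩
  have := Fact.mk hp
  obtain ⟨hne, hle⟩ := index_ker_pi_torsionCharacter F hp.ne_zero
  have hdvd := AddSubgroup.index_dvd_of_le (K := G.pTorsionIn p)
    (H := (AddMonoidHom.pi fun χ : F => torsionCharacter χ.1 p).ker) fun x hx =>
      ⟨hF p hp x (mem_torsionBy_iff_nsmul.1 x.2) fun χ hχ =>
        congrArg Subtype.val (congrFun hx ⟨χ, hχ⟩), x.2⟩
  have : Finite (AddSubgroup.torsionBy M (p : ℤ) ⧸ G.pTorsionIn p) :=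
    Nat.finite_of_card_ne_zero (ne_zero_of_dvd_ne_zero hne hdvd)
  exact pRank_le_of_card_le_pow ((Nat.le_of_dvd (Nat.pos_of_ne_zero hne) hdvd).trans hle)

end TorsionRank

section DeltaSubgroups

theorem zsmul_character_apply {M : Type*} [AddCommGroup M] [TopologicalSpace M] (m : ℤ)
    (χ : M →ₜ+ UnitAddCircle) (x : M) : (m • χ) x = m • χ x :=
  map_zsmul (evalAt x) m χ

theorem surjective_evalCharacters {ι M : Type*} [AddCommGroup M] [TopologicalSpace M]
    [CompactSpace M] {v : ι → (M →ₜ+ UnitAddCircle)} (hv : LinearIndependent ℤ v) :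
    Function.Surjective (evalCharacters v) := by
  intro g
  obtain ⟨h, hh⟩ := exists_hom_of_linearIndependent hv g
  obtain ⟨x, hx⟩ := exists_eval_eq h
  exact ⟨x, funext fun i => (hx _).trans (hh i)⟩

theorem isTorus_quotient_ker_evalCharacters {ι M : Type u} [AddCommGroup M] [TopologicalSpace M]
    [CompactSpace M] {v : ι → (M →ₜ+ UnitAddCircle)}
    (hv : Function.Surjective (evalCharacters v)) : IsTorus (M ⧸ (evalCharacters v).ker) := by
  let e := QuotientAddGroup.quotientKerEquivOfSurjective _ hv
  have he : Continuous e := continuous_quot_lift _ (continuous_evalCharacters v)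
  exact ⟨ι, ⟨{ e with
    continuous_toFun := he
    continuous_invFun := he.continuous_symm_of_equiv_compact_to_t2 }⟩⟩

theorem apply_eq_zero_of_mem_span {ι M : Type*} [AddCommGroup M] [TopologicalSpace M]
    {v : ι → (M →ₜ+ UnitAddCircle)} {χ : M →ₜ+ UnitAddCircle}
    (hχ : χ ∈ Submodule.span ℤ (Set.range v)) {x : M} (hx : x ∈ (evalCharacters v).ker) :
    χ x = 0 := by
  induction hχ using Submodule.span_induction with
  | mem χ hχ =>
    obtain ⟨i, rfl⟩ := hχ
    exact congrFun hx i
  | zero => rfl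
  | add χ ψ _ _ hχ hψ => exact (congrArg₂ (· + ·) hχ hψ).trans (add_zero 0)
  | smul n χ _ hχ => rw [zsmul_character_apply, hχ, smul_zero]

variable {K : Type u} [AddCommGroup K] [TopologicalSpace K] [IsTopologicalAddGroup K]
  [CompactSpace K] [T2Space K]

theorem isTotallyDisconnected_of_forall_character {N : Set K}
    (hN : ∀ χ : K →ₜ+ UnitAddCircle, ∃ m : ℕ, m ≠ 0 ∧ ∀ x ∈ N, m • χ x = 0) :
    IsTotallyDisconnected N := by
  intro C hCN hC x hx y hy
  refine eq_of_forall_character fun χ => ?_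
  obtain ⟨m, hm0, hm⟩ := hN χ
  have hfin : (χ '' C).Finite :=
    (AddCircle.finite_torsion 1 (Nat.pos_of_ne_zero hm0)).subset
      (Set.image_subset_iff.2 fun z hz => hm z (hCN hz))
  exact hfin.countable.isTotallyDisconnected _ subset_rfl
    (hC.image χ χ.continuous_toFun.continuousOn) ⟨x, hx, rfl⟩ ⟨y, hy, rfl⟩

/-- The kernel of a maximal independent family of characters vanishing on `N`. -/
theorem exists_isDeltaSubgroup_ge {N : AddSubgroup K} (hN : IsClosed (N : Set K))
    (hd : IsTotallyDisconnected (N : Set K)) : ∃ M : AddSubgroup K, M.IsDeltaSubgroup ∧ N ≤ M := by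
  have : CompactSpace N := isCompact_iff_compactSpace.1 hN.isCompact
  have : TotallyDisconnectedSpace N := totallyDisconnectedSpace_subtype_iff.2 hd
  let w : {χ : K →ₜ+ UnitAddCircle // ∀ x ∈ N, χ x = 0} → (K →ₜ+ UnitAddCircle) := Subtype.val
  obtain ⟨s, hs, hmax⟩ := exists_maximal_linearIndepOn ℤ w
  let v : s → (K →ₜ+ UnitAddCircle) := fun i => w i
  have hrange : Set.range v = w '' s := (Set.image_eq_range w s).symm
  have hannihilated (χ : K →ₜ+ UnitAddCircle) (hχ : ∀ x ∈ N, χ x = 0) :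
      ∃ a : ℤ, a ≠ 0 ∧ ∀ x ∈ (evalCharacters v).ker, a • χ x = 0 := by
    by_cases hχs : ⟨χ, hχ⟩ ∈ s
    · exact ⟨1, one_ne_zero, fun x hx => (one_smul ℤ _).trans (congrFun hx ⟨_, hχs⟩)⟩
    · obtain ⟨a, ha0, ha⟩ := hmax _ hχs
      refine ⟨a, ha0, fun x hx => ?_⟩
      rw [← zsmul_character_apply]
      exact apply_eq_zero_of_mem_span (hrange ▸ ha) hx
  refine ⟨(evalCharacters v).ker, ⟨isClosed_singleton.preimage (continuous_evalCharacters v),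
    isTotallyDisconnected_of_forall_character fun χ => ?_,
    isTorus_quotient_ker_evalCharacters (surjective_evalCharacters hs)⟩,
    fun x hx => funext fun i => (i : {χ : K →ₜ+ UnitAddCircle // ∀ x ∈ N, χ x = 0}).2 x hx⟩
  obtain ⟨d, hd0, hdN⟩ :=
    exists_nsmul_character_eq_zero (χ.comp ⟨N.subtype, continuous_subtype_val⟩)
  obtain ⟨a, ha0, ha⟩ := hannihilated ((d : ℤ) • χ) fun x hx => by
    rw [zsmul_character_apply, natCast_zsmul]
    exact hdN ⟨x, hx⟩
  refine ⟨(a * d).natAbs, Int.natAbs_ne_zero.2 (mul_ne_zero ha0 (mod_cast hd0)), fun x hx => ?_⟩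
  rw [natAbs_nsmul_eq_zero, mul_smul, ← zsmul_character_apply, ha x hx]

end DeltaSubgroups

end CompactAbelian

namespace Sperner

open Finset

section Labels

variable {m : ℕ}

/-- The labels `0, …, m` all occur, as on a simplex that carries all labels. -/
def Full {α : Type*} (m : ℕ) (l : α → ℕ) : Prop := Set.Iic m ⊆ Set.range l

/-- The labels `1, …, m` all occur, as on a facet counted in the parity argument. -/
def Door {α : Type*} (m : ℕ) (l : α → ℕ) : Prop := Set.Icc 1 m ⊆ Set.range l

theorem injective_of_subset_range {α : Type*} [Fintype α] {l : α → ℕ} {s : Finset ℕ}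
    (hs : Fintype.card α ≤ #s) (hl : ↑s ⊆ Set.range l) : Function.Injective l := by
  have himage : s ⊆ univ.image l := fun c hc => by simpa using hl hc
  exact Set.injOn_univ.1 (by
    simpa using injOn_of_card_image_eq (card_image_le.antisymm (hs.trans (card_le_card himage))))

theorem Door.injective {l : Fin m → ℕ} (h : Door m l) : Function.Injective l :=
  injective_of_subset_range (s := Icc 1 m) (by simp) (by rwa [coe_Icc])

theorem Full.injective {l : Fin (m + 1) → ℕ} (h : Full m l) : Function.Injective l :=
  injective_of_subset_range (s := Iic m) (by simp) (by rwa [coe_Iic])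

theorem door_removeNth_iff {l : Fin (m + 1) → ℕ} {k : Fin (m + 1)} :
    Door m (k.removeNth l) ↔ Door m l ∧ (l k ∈ Set.Icc 1 m → ∃ j ≠ k, l j = l k) := by
  have hrange : ∀ c, c ∈ Set.range (k.removeNth l) ↔ ∃ j ≠ k, l j = c := fun c =>
    ⟨fun ⟨i, hi⟩ => ⟨_, Fin.succAbove_ne k i, hi⟩, fun ⟨j, hj, hc⟩ => by
      obtain ⟨i, rfl⟩ := Fin.exists_succAbove_eq hj
      exact ⟨i, hc⟩⟩
  refine ⟨fun h => ⟨fun c hc => ?_, fun hk => (hrange _).1 (h hk)⟩, fun ⟨h, hk⟩ c hc => ?_⟩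
  · obtain ⟨j, -, hj⟩ := (hrange c).1 (h hc)
    exact ⟨j, hj⟩
  · obtain ⟨j, rfl⟩ := h hc
    rcases eq_or_ne j k with rfl | hjk
    · exact (hrange _).2 (hk hc)
    · exact (hrange _).2 ⟨j, hjk, rfl⟩

/-- The indicator of a proposition, modulo two. -/
noncomputable def parity (P : Prop) : ZMod 2 :=
  open Classical in if P then 1 else 0

theorem parity_of {P : Prop} (h : P) : parity P = 1 := if_pos h

theorem parity_of_not {P : Prop} (h : ¬ P) : parity P = 0 := if_neg h

theorem sum_parity_door_of_full {l : Fin (m + 1) → ℕ} (hl : ∀ j, l j ≤ m) (h : Full m l) :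
    ∑ k : Fin (m + 1), parity (Door m (k.removeNth l)) = 1 := by
  have hdoor : Door m l := Set.Icc_subset_Iic_self.trans h
  obtain ⟨k₀, hk₀⟩ := h (Nat.zero_le m)
  rw [sum_eq_single k₀ (fun k _ hk => parity_of_not fun hd => ?_) (by simp)]
  · exact parity_of (door_removeNth_iff.2 ⟨hdoor, by simp [hk₀]⟩)
  · have hlk : l k ≠ 0 := fun h0 => hk (h.injective (h0.trans hk₀.symm))
    obtain ⟨j, hjk, hj⟩ := (door_removeNth_iff.1 hd).2 ⟨Nat.one_le_iff_ne_zero.2 hlk, hl k⟩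
    exact hjk (h.injective hj)

/-- If the labels `1, …, m` occur on `m + 1` vertices but `0` does not, exactly one of them is
repeated, and the doors are the two facets opposite its occurrences. -/
theorem sum_parity_door_of_not_full {l : Fin (m + 1) → ℕ} (hl : ∀ j, l j ≤ m) (h : ¬ Full m l) :
    ∑ k : Fin (m + 1), parity (Door m (k.removeNth l)) = 0 := by
  by_cases hdoor : Door m l
  swap
  · exact sum_eq_zero fun k _ => parity_of_not fun hd => hdoor (door_removeNth_iff.1 hd).1
  have hl1 : ∀ j, l j ∈ Set.Icc 1 m := fun j =>
    ⟨Nat.one_le_iff_ne_zero.2 fun hj => h fun c hc => by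
      rcases Nat.eq_zero_or_pos c with rfl | hc0
      · exact ⟨j, hj⟩
      · exact hdoor ⟨hc0, hc⟩, hl j⟩
  obtain ⟨a, -, b, -, hab, hlab⟩ := exists_ne_map_eq_of_card_lt_of_maps_to
    (s := univ) (t := Icc 1 m) (f := l) (by simp) (by simpa using hl1)
  have hother : ∀ k, k ≠ a → k ≠ b → ¬ Door m (k.removeNth l) := by
    intro k hka hkb hd
    obtain ⟨i, rfl⟩ := Fin.exists_succAbove_eq hka.symm
    obtain ⟨j, rfl⟩ := Fin.exists_succAbove_eq hkb.symm
    exact hab (congrArg k.succAbove (hd.injective hlab))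
  rw [← sum_subset (subset_univ {a, b}) fun k _ hk => parity_of_not (by
      simp only [mem_insert, mem_singleton, not_or] at hk
      exact hother k hk.1 hk.2),
    sum_pair hab, parity_of (door_removeNth_iff.2 ⟨hdoor, fun _ => ⟨b, hab.symm, hlab.symm⟩⟩),
    parity_of (door_removeNth_iff.2 ⟨hdoor, fun _ => ⟨a, hab, hlab⟩⟩), CharTwo.add_self_eq_zero]

theorem sum_parity_door {l : Fin (m + 1) → ℕ} (hl : ∀ j, l j ≤ m) :
    ∑ k : Fin (m + 1), parity (Door m (k.removeNth l)) = parity (Full m l) := by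
  by_cases h : Full m l
  · rw [sum_parity_door_of_full hl h, parity_of h]
  · rw [sum_parity_door_of_not_full hl h, parity_of_not h]

end Labels

section Grid

variable {m N : ℕ}

/-- The points of `ℕᵐ` with all coordinates below `N`, the least vertices of the unit cubes of a
grid of side `N`. -/
def box (m N : ℕ) : Finset (Fin m → ℕ) := Fintype.piFinset fun _ => range N

theorem mem_box {x : Fin m → ℕ} : x ∈ box m N ↔ ∀ i, x i < N := by
  simp [box]

theorem sum_box_add_single {R : Type*} [AddCommMonoid R] (i : Fin m) (h : (Fin m → ℕ) → R)
    (hN : ∀ x, (∀ j ≠ i, x j < N) → x i = N → h x = 0) :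
    ∑ x ∈ box m N, h (x + Pi.single i 1) = ∑ x ∈ box m N with x i ≠ 0, h x := by
  refine (sum_map (box m N) (addRightEmbedding (Pi.single i 1)) h).symm.trans
    (sum_subset (fun x hx => ?_) fun x hx hx' => ?_).symm
  · rw [mem_filter, mem_box] at hx
    refine mem_map.2 ⟨x - Pi.single i 1,
      mem_box.2 fun j => (Nat.sub_le _ _).trans_lt (hx.1 j), ?_⟩
    refine tsub_add_cancel_of_le fun j => ?_
    rcases eq_or_ne j i with rfl | hji
    · simpa using Nat.one_le_iff_ne_zero.2 hx.2
    · simp [hji]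
  · obtain ⟨y, hy, rfl⟩ := mem_map.1 hx
    rw [mem_box] at hy
    have hj : ∀ j ≠ i, (y + Pi.single i 1 : Fin m → ℕ) j < N := fun j hj => by
      simpa [hj] using hy j
    refine hN _ hj (le_antisymm (by simpa using hy i) (not_lt.1 fun hi => hx' ?_))
    refine mem_filter.2 ⟨mem_box.2 fun j => ?_, by simp⟩
    rcases eq_or_ne j i with rfl | hji
    exacts [hi, hj j hji]

theorem sum_box_add_single_add {R : Type*} [Semiring R] [CharP R 2] (i : Fin m)
    (h : (Fin m → ℕ) → R) (hN : ∀ x, (∀ j ≠ i, x j < N) → x i = N → h x = 0) :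
    ∑ x ∈ box m N, (h (x + Pi.single i 1) + h x) = ∑ x ∈ box m N with x i = 0, h x := by
  rw [sum_add_distrib, sum_box_add_single i h hN,
    ← sum_filter_add_sum_filter_not (box m N) (fun x => x i = 0) h, add_left_comm,
    CharTwo.add_self_eq_zero, add_zero]

end Grid

section Simplices

variable {m N : ℕ}

/-- The vertices of a simplex of the Kuhn triangulation, from the greatest to the least vertex `x`:
the direction `i` is removed after the `ρ i`-th vertex. -/
def simplex (ρ : Equiv.Perm (Fin m)) (x : Fin m → ℕ) (j : Fin (m + 1)) : Fin m → ℕ :=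
  fun i => x i + if (j : ℕ) ≤ ρ i then 1 else 0

theorem simplex_apply_le (ρ : Equiv.Perm (Fin m)) {x : Fin m → ℕ} (hx : x ∈ box m N)
    (j : Fin (m + 1)) (i : Fin m) : simplex ρ x j i ≤ N := by
  have := mem_box.1 hx i
  unfold simplex
  split_ifs <;> omega

theorem removeNth_simplex_swap (ρ : Equiv.Perm (Fin (m + 1))) (x : Fin (m + 1) → ℕ) (k : Fin m) :
    k.castSucc.succ.removeNth (simplex (Equiv.swap k.castSucc k.succ * ρ) x) =
      k.castSucc.succ.removeNth (simplex ρ x) := by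
  funext j i
  have hj : (k.castSucc.succ.succAbove j : ℕ) ≠ k + 1 := fun h =>
    Fin.succAbove_ne k.castSucc.succ j (Fin.ext (by simpa using h))
  have hle : (k.castSucc.succ.succAbove j : ℕ) ≤ (Equiv.swap k.castSucc k.succ * ρ) i ↔
      (k.castSucc.succ.succAbove j : ℕ) ≤ ρ i := by
    rw [Equiv.Perm.mul_apply, Equiv.swap_apply_def]
    split_ifs with h1 h2
    · rw [h1, Fin.val_succ, Fin.val_castSucc]; omega
    · rw [h2, Fin.val_succ, Fin.val_castSucc]; omega
    · rfl
  simp only [Fin.removeNth, simplex, hle]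

theorem init_simplex (ρ : Equiv.Perm (Fin (m + 1))) (x : Fin (m + 1) → ℕ) :
    Fin.init (simplex ρ x) = Fin.tail (simplex (finRotate (m + 1) * ρ)
      (x + Pi.single ((finRotate (m + 1) * ρ).symm 0) 1)) := by
  funext j i
  by_cases hi : ρ i = Fin.last m
  · have hi0 : (finRotate (m + 1) * ρ) i = 0 := by
      rw [Equiv.Perm.mul_apply, hi, finRotate_last]
    simp [Fin.init, Fin.tail, simplex, hi0, hi, (Equiv.symm_apply_eq _).2 hi0.symm, j.is_le]
  · have hi1 : ((finRotate (m + 1) * ρ) i : ℕ) = ρ i + 1 := coe_finRotate_of_ne_last hi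
    have hi0 : i ≠ (finRotate (m + 1) * ρ).symm 0 := fun h => by
      rw [Equiv.eq_symm_apply] at h
      simp [h] at hi1
    simp only [Fin.init, Fin.tail, simplex, Fin.val_castSucc, Fin.val_succ, hi1, Pi.add_apply,
      Pi.single_eq_of_ne hi0, add_zero, Nat.add_le_add_iff_right]

theorem sum_removeNth_simplex_eq_zero {R : Type*} [Semiring R] [CharP R 2]
    (F : (Fin (m + 1) → Fin (m + 1) → ℕ) → R) (x : Fin (m + 1) → ℕ) (k : Fin m) :
    ∑ ρ, F (k.castSucc.succ.removeNth (simplex ρ x)) = 0 := by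
  refine sum_involution (fun ρ _ => Equiv.swap k.castSucc k.succ * ρ)
    (fun ρ _ => ?_) (fun ρ _ _ h => ?_) (fun ρ _ => mem_univ _) (fun ρ _ => ?_)
  · rw [removeNth_simplex_swap, CharTwo.add_self_eq_zero]
  · exact Fin.castSucc_lt_succ.ne (Equiv.swap_eq_one_iff.1 (mul_eq_right.1 h))
  · rw [← mul_assoc, Equiv.swap_mul_self, one_mul]

/-- The boundary formula modulo two: interior facets lie on two simplices, so only those in the
faces of the cube contribute. -/
theorem sum_removeNth_simplex {R : Type*} [Semiring R] [CharP R 2]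
    (F : (Fin (m + 1) → Fin (m + 1) → ℕ) → R)
    (hF : ∀ ρ x, (∀ i ≠ ρ.symm 0, x i < N) → x (ρ.symm 0) = N →
      F (Fin.tail (simplex ρ x)) = 0) :
    ∑ ρ, ∑ x ∈ box (m + 1) N, ∑ k : Fin (m + 2), F (k.removeNth (simplex ρ x)) =
      ∑ ρ, ∑ x ∈ box (m + 1) N with x (ρ.symm 0) = 0, F (Fin.tail (simplex ρ x)) := by
  have hmid : ∑ ρ, ∑ x ∈ box (m + 1) N,
      ∑ k : Fin m, F (k.castSucc.succ.removeNth (simplex ρ x)) = 0 := by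
    rw [sum_comm]
    refine sum_eq_zero fun x _ => ?_
    rw [sum_comm]
    exact sum_eq_zero fun k _ => sum_removeNth_simplex_eq_zero F x k
  have hlast : ∑ ρ, ∑ x ∈ box (m + 1) N, F (Fin.init (simplex ρ x)) =
      ∑ ρ, ∑ x ∈ box (m + 1) N, F (Fin.tail (simplex ρ (x + Pi.single (ρ.symm 0) 1))) :=
    Fintype.sum_bijective (finRotate (m + 1) * ·) (Group.mulLeft_bijective _) _ _
      fun ρ => sum_congr rfl fun x _ => congrArg F (init_simplex ρ x)
  simp only [Fin.sum_univ_succ (n := m + 1), Fin.sum_univ_castSucc (n := m), Fin.succ_last,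
    sum_add_distrib, hmid, zero_add, Fin.removeNth_zero, Fin.removeNth_last, hlast]
  rw [add_comm, ← sum_add_distrib]
  refine sum_congr rfl fun ρ _ => ?_
  rw [← sum_add_distrib, sum_box_add_single_add _ (fun x => F (Fin.tail (simplex ρ x))) (hF ρ)]

theorem simplex_decomposeFin_succ (e : Equiv.Perm (Fin m)) (y : Fin m → ℕ) (j : Fin (m + 1)) :
    simplex (Equiv.Perm.decomposeFin.symm (0, e)) (Fin.cons 0 y : Fin (m + 1) → ℕ) j.succ =
      Fin.cons 0 (simplex e y j) := by
  funext i
  refine Fin.cases ?_ (fun i => ?_) i <;> simp [simplex]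

theorem sum_box_face {R : Type*} [AddCommMonoid R] (hN : 0 < N)
    (f : (Fin (m + 1) → ℕ) → R) :
    ∑ x ∈ box (m + 1) N with x 0 = 0, f x = ∑ y ∈ box m N, f (Fin.cons 0 y) := by
  refine sum_bij' (fun x _ => Fin.tail x) (fun y _ => Fin.cons 0 y)
    (fun x hx => ?_) (fun y hy => ?_) (fun x hx => ?_) (fun y _ => Fin.tail_cons _ _)
    (fun x hx => ?_)
  · exact mem_box.2 fun i => mem_box.1 (mem_filter.1 hx).1 i.succ
  · exact mem_filter.2 ⟨mem_box.2 (Fin.cases hN (mem_box.1 hy)), rfl⟩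
  all_goals
    have hx0 := Fin.cons_self_tail x
    rw [(mem_filter.1 hx).2] at hx0
    rw [hx0]

end Simplices

section Labelling

variable {m N : ℕ} {lam : (Fin m → ℕ) → ℕ}

/-- A labelling of the points of a grid of side `N` by `0, …, m` with the boundary conditions of
the Sperner lemma for a cube. -/
structure Labelling (m N : ℕ) (lam : (Fin m → ℕ) → ℕ) : Prop where
  le : ∀ x, (∀ i, x i ≤ N) → lam x ≤ m
  bottom : ∀ x, (∀ i, x i ≤ N) → ∀ i : Fin m, x i = 0 → (i : ℕ) + 1 ≤ lam x
  top : ∀ x, (∀ i, x i ≤ N) → ∀ i : Fin m, x i = N → lam x ≠ (i : ℕ) + 1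

theorem cons_zero_apply_le {y : Fin m → ℕ} (hy : ∀ i, y i ≤ N) (i : Fin (m + 1)) :
    (Fin.cons 0 y : Fin (m + 1) → ℕ) i ≤ N :=
  Fin.cases (Nat.zero_le N) hy i

theorem Labelling.one_le_cons_zero {lam : (Fin (m + 1) → ℕ) → ℕ} (h : Labelling (m + 1) N lam)
    {y : Fin m → ℕ} (hy : ∀ i, y i ≤ N) : 1 ≤ lam (Fin.cons 0 y) := by
  simpa using h.bottom _ (cons_zero_apply_le hy) 0 rfl

theorem Labelling.face {lam : (Fin (m + 1) → ℕ) → ℕ} (h : Labelling (m + 1) N lam) :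
    Labelling m N (fun y => lam (Fin.cons 0 y) - 1) := by
  refine ⟨fun y hy => ?_, fun y hy i hi => ?_, fun y hy i hi => ?_⟩
  · exact Nat.sub_le_of_le_add (h.le _ (cons_zero_apply_le hy))
  · exact Nat.le_sub_of_add_le (h.bottom _ (cons_zero_apply_le hy) i.succ hi)
  · have hone := h.one_le_cons_zero hy
    have htop := h.top _ (cons_zero_apply_le hy) i.succ hi
    rw [Fin.val_succ] at htop
    omega

theorem Labelling.parity_door_eq_zero_of_top {lam : (Fin (m + 1) → ℕ) → ℕ}
    (h : Labelling (m + 1) N lam) {ρ : Equiv.Perm (Fin (m + 1))} {x : Fin (m + 1) → ℕ}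
    (hx : ∀ i ≠ ρ.symm 0, x i < N) (hxN : x (ρ.symm 0) = N) :
    parity (Door (m + 1) (lam ∘ Fin.tail (simplex ρ x))) = 0 := by
  refine parity_of_not fun hd => ?_
  obtain ⟨j, hj⟩ := hd ⟨Nat.le_add_left 1 (ρ.symm 0), (ρ.symm 0).is_lt⟩
  refine h.top _ (fun i => ?_) (ρ.symm 0) ?_ hj
  · rcases eq_or_ne i (ρ.symm 0) with rfl | hi
    · simp [Fin.tail, simplex, hxN]
    · have := hx i hi
      unfold Fin.tail simplex
      split_ifs <;> omega
  · simp [Fin.tail, simplex, hxN]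

theorem Labelling.parity_door_eq_zero_of_bottom {lam : (Fin (m + 1) → ℕ) → ℕ}
    (h : Labelling (m + 1) N lam) {ρ : Equiv.Perm (Fin (m + 1))} {x : Fin (m + 1) → ℕ}
    (hx : x ∈ box (m + 1) N) (hx0 : x (ρ.symm 0) = 0) (hρ : ρ.symm 0 ≠ 0) :
    parity (Door (m + 1) (lam ∘ Fin.tail (simplex ρ x))) = 0 := by
  refine parity_of_not fun hd => hρ (Fin.ext ?_)
  obtain ⟨j, hj⟩ := hd ⟨le_rfl, Nat.le_add_left 1 m⟩
  have hle := h.bottom _ (simplex_apply_le ρ hx j.succ) (ρ.symm 0) (by simp [simplex, hx0])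
  rw [show lam (simplex ρ x j.succ) = 1 from hj] at hle
  simpa using hle

theorem door_succ_iff_full {α : Type*} {l : α → ℕ} (hl : ∀ j, 1 ≤ l j) :
    Door (m + 1) l ↔ Full m fun j => l j - 1 := by
  refine ⟨fun h c hc => ?_, fun h c ⟨h1, hc⟩ => ?_⟩
  · obtain ⟨j, hj⟩ := h ⟨Nat.le_add_left 1 c, Nat.succ_le_succ hc⟩
    exact ⟨j, by simp [hj]⟩
  · obtain ⟨j, hj⟩ := h (Nat.sub_le_of_le_add hc : c - 1 ≤ m)
    have := hl j
    exact ⟨j, by dsimp only at hj; omega⟩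

theorem Labelling.door_iff_full {lam : (Fin (m + 1) → ℕ) → ℕ} (h : Labelling (m + 1) N lam)
    (e : Equiv.Perm (Fin m)) {y : Fin m → ℕ} (hy : y ∈ box m N) :
    Door (m + 1) (lam ∘ Fin.tail
        (simplex (Equiv.Perm.decomposeFin.symm (0, e)) (Fin.cons 0 y : Fin (m + 1) → ℕ))) ↔
      Full m fun j => lam (Fin.cons 0 (simplex e y j)) - 1 := by
  have hcomp : lam ∘ Fin.tail
      (simplex (Equiv.Perm.decomposeFin.symm (0, e)) (Fin.cons 0 y : Fin (m + 1) → ℕ)) =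
      fun j => lam (Fin.cons 0 (simplex e y j)) :=
    funext fun j => congrArg lam (simplex_decomposeFin_succ e y j)
  rw [hcomp]
  exact door_succ_iff_full fun j => h.one_le_cons_zero (simplex_apply_le e hy j)

/-- The doors in the boundary of the cube are the full simplices of its face `x 0 = 0`. -/
theorem Labelling.sum_parity_door_boundary {lam : (Fin (m + 1) → ℕ) → ℕ}
    (h : Labelling (m + 1) N lam) (hN : 0 < N) :
    ∑ ρ : Equiv.Perm (Fin (m + 1)), ∑ x ∈ box (m + 1) N with x (ρ.symm 0) = 0,
        parity (Door (m + 1) (lam ∘ Fin.tail (simplex ρ x))) =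
      ∑ e : Equiv.Perm (Fin m), ∑ y ∈ box m N,
        parity (Full m fun j => lam (Fin.cons 0 (simplex e y j)) - 1) := by
  have hsymm : ∀ p (e : Equiv.Perm (Fin m)),
      (Equiv.Perm.decomposeFin.symm (p, e)).symm 0 = 0 ↔ p = 0 := fun p e => by
    rw [Equiv.symm_apply_eq, Equiv.Perm.decomposeFin_symm_apply_zero, eq_comm]
  rw [← Equiv.sum_comp Equiv.Perm.decomposeFin.symm, Fintype.sum_prod_type,
    Fintype.sum_eq_single 0 fun p hp => sum_eq_zero fun e _ => sum_eq_zero fun x hx =>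
      h.parity_door_eq_zero_of_bottom (mem_filter.1 hx).1 (mem_filter.1 hx).2
        (mt (hsymm p e).1 hp)]
  refine sum_congr rfl fun e _ => ?_
  rw [(hsymm 0 e).2 rfl, sum_box_face hN]
  exact sum_congr rfl fun y hy => congrArg parity (propext (h.door_iff_full e hy))

/-- **The Sperner lemma** for the Kuhn triangulation of a cube. -/
theorem Labelling.sum_parity_full (hN : 0 < N) (h : Labelling m N lam) :
    ∑ ρ : Equiv.Perm (Fin m), ∑ x ∈ box m N, parity (Full m (lam ∘ simplex ρ x)) = 1 := by
  induction m with
  | zero =>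
    have hbox : box 0 N = {default} :=
      eq_singleton_iff_unique_mem.2 ⟨mem_box.2 fun i => i.elim0, fun _ _ => Subsingleton.elim _ _⟩
    rw [Fintype.sum_unique, hbox, sum_singleton, parity_of]
    intro c hc
    rw [Nat.le_zero.1 hc]
    exact ⟨0, Nat.le_zero.1 (h.le _ fun i => i.elim0)⟩
  | succ m ih =>
    calc ∑ ρ : Equiv.Perm (Fin (m + 1)), ∑ x ∈ box (m + 1) N,
          parity (Full (m + 1) (lam ∘ simplex ρ x))
        = ∑ ρ : Equiv.Perm (Fin (m + 1)), ∑ x ∈ box (m + 1) N, ∑ k : Fin (m + 2),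
            parity (Door (m + 1) (lam ∘ k.removeNth (simplex ρ x))) :=
          sum_congr rfl fun ρ _ => sum_congr rfl fun x hx =>
            (sum_parity_door fun j => h.le _ (simplex_apply_le ρ hx j)).symm
      _ = ∑ ρ : Equiv.Perm (Fin (m + 1)), ∑ x ∈ box (m + 1) N with x (ρ.symm 0) = 0,
            parity (Door (m + 1) (lam ∘ Fin.tail (simplex ρ x))) :=
          sum_removeNth_simplex (fun v => parity (Door (m + 1) (lam ∘ v)))
            fun _ _ => h.parity_door_eq_zero_of_top
      _ = _ := h.sum_parity_door_boundary hN
      _ = 1 := ih h.face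

theorem Labelling.exists_full (hN : 0 < N) (h : Labelling m N lam) :
    ∃ ρ : Equiv.Perm (Fin m), ∃ x ∈ box m N, Full m (lam ∘ simplex ρ x) := by
  by_contra! hne
  have hsum := h.sum_parity_full hN
  rw [sum_eq_zero fun ρ _ => sum_eq_zero fun x hx => parity_of_not (hne ρ x hx)] at hsum
  exact zero_ne_one hsum

end Labelling

section CubeCover

variable {m N : ℕ}

/-- The largest `i + 1` such that `U` misses the face `t i = 1` of the cube, or zero. Labelling a
grid point by a member of a cover containing it turns a cover into a Sperner labelling. -/
noncomputable def faceLabel (U : Set (Fin m → ℝ)) : ℕ :=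
  open Classical in
  Finset.univ.sup fun i : Fin m => if Disjoint U {t | t i = 1} then (i : ℕ) + 1 else 0

theorem faceLabel_le (U : Set (Fin m → ℝ)) : faceLabel U ≤ m :=
  Finset.sup_le fun i _ => by
    split_ifs
    exacts [i.is_lt, Nat.zero_le m]

theorem succ_le_faceLabel {U : Set (Fin m → ℝ)} {i : Fin m} (h : Disjoint U {t | t i = 1}) :
    (i : ℕ) + 1 ≤ faceLabel U := by
  classical
  simpa only [faceLabel, if_pos h] using Finset.le_sup
    (f := fun i : Fin m => if Disjoint U {t | t i = 1} then (i : ℕ) + 1 else 0)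
    (Finset.mem_univ i)

theorem disjoint_of_faceLabel_eq {U : Set (Fin m → ℝ)} {i : Fin m}
    (h : faceLabel U = (i : ℕ) + 1) : Disjoint U {t | t i = 1} := by
  classical
  obtain ⟨j, -, hj⟩ := Finset.exists_mem_eq_sup Finset.univ ⟨i, Finset.mem_univ i⟩
    fun i : Fin m => if Disjoint U {t | t i = 1} then (i : ℕ) + 1 else 0
  split_ifs at hj with hd
  · rwa [Fin.ext (Nat.succ_injective (h.symm.trans hj))]
  · exact absurd (h.symm.trans hj) (Nat.succ_ne_zero _)

/-- The point of the unit cube that corresponds to a point of the grid of side `N`. -/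
noncomputable def gridPoint (N : ℕ) (x : Fin m → ℕ) : Fin m → ℝ := fun i => x i / N

theorem gridPoint_mem_Icc {x : Fin m → ℕ} (hx : ∀ i, x i ≤ N) :
    gridPoint N x ∈ Set.Icc (0 : Fin m → ℝ) 1 :=
  ⟨fun i => by simp only [gridPoint, Pi.zero_apply]; positivity,
    fun i => div_le_one_of_le₀ (Nat.cast_le.2 (hx i)) N.cast_nonneg⟩

theorem dist_gridPoint_simplex_le (ρ : Equiv.Perm (Fin m)) (x : Fin m → ℕ) (j : Fin (m + 1)) :
    dist (gridPoint N x) (gridPoint N (simplex ρ x j)) ≤ 1 / N := by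
  refine (dist_pi_le_iff (by positivity)).2 fun i => ?_
  rw [dist_comm, Real.dist_eq, gridPoint, gridPoint, ← sub_div, abs_div, Nat.abs_cast]
  refine div_le_div_of_nonneg_right ?_ N.cast_nonneg
  unfold simplex
  split_ifs <;> simp

theorem exists_closedBall_gridPoint_subset {κ : Type*} {V : κ → Set (Fin m → ℝ)}
    (hV : ∀ j, IsOpen (V j)) (hcover : Set.Icc 0 1 ⊆ ⋃ j, V j) :
    ∃ N > 0, ∃ J : (Fin m → ℕ) → κ, ∀ x, (∀ i, x i ≤ N) →
      Metric.closedBall (gridPoint N x) (1 / N) ⊆ V (J x) := by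
  obtain ⟨δ, hδ, hball⟩ := lebesgue_number_lemma_of_metric isCompact_Icc hV hcover
  obtain ⟨N, hN⟩ := exists_nat_one_div_lt hδ
  obtain ⟨j, -⟩ := hball 0 ⟨le_rfl, zero_le_one⟩
  have : Nonempty κ := ⟨j⟩
  choose! J hJ using hball
  exact ⟨N + 1, N.succ_pos, fun x => J (gridPoint (N + 1) x), fun x hx =>
    (Metric.closedBall_subset_ball (mod_cast hN)).trans (hJ _ (gridPoint_mem_Icc hx))⟩

theorem labelling_faceLabel {κ : Type*} {V : κ → Set (Fin m → ℝ)} {J : (Fin m → ℕ) → κ}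
    (hN : 0 < N) (hJ : ∀ x, (∀ i, x i ≤ N) → gridPoint N x ∈ V (J x))
    (hface : ∀ j i, Disjoint (V j) {t | t i = 0} ∨ Disjoint (V j) {t | t i = 1}) :
    Labelling m N fun x => faceLabel (V (J x)) where
  le _ _ := faceLabel_le _
  bottom x hx i hi := succ_le_faceLabel ((hface (J x) i).resolve_left
    (Set.not_disjoint_iff.2 ⟨_, hJ x hx, by simp [gridPoint, hi]⟩))
  top x hx i hi h := Set.disjoint_left.1 (disjoint_of_faceLabel_eq h) (hJ x hx)
    (by simp [gridPoint, hi, hN.ne'])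

/-- **The covering theorem of Lebesgue** for a cube. -/
theorem exists_lt_ncard_of_cover {κ : Type*} [Finite κ] {V : κ → Set (Fin m → ℝ)}
    (hV : ∀ j, IsOpen (V j)) (hcover : Set.Icc 0 1 ⊆ ⋃ j, V j)
    (hface : ∀ j i, Disjoint (V j) {t | t i = 0} ∨ Disjoint (V j) {t | t i = 1}) :
    ∃ t, m < {j | t ∈ V j}.ncard := by
  obtain ⟨N, hN, J, hJ⟩ := exists_closedBall_gridPoint_subset hV hcover
  obtain ⟨ρ, x, hx, hfull⟩ := (labelling_faceLabel hN
    (fun x hx => hJ x hx (Metric.mem_closedBall_self (by positivity))) hface).exists_full hN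
  have hmem : ∀ k, gridPoint N x ∈ V (J (simplex ρ x k)) := fun k =>
    hJ _ (simplex_apply_le ρ hx k) (dist_gridPoint_simplex_le ρ x k)
  have hinjective : Function.Injective fun k => J (simplex ρ x k) := fun k l hkl =>
    hfull.injective (congrArg (fun j => faceLabel (V j)) hkl)
  refine ⟨gridPoint N x, ?_⟩
  calc m < (Set.range fun k => J (simplex ρ x k)).ncard := by
        rw [← Set.image_univ, Set.ncard_image_of_injective _ hinjective, Set.ncard_univ,
          Nat.card_fin]
        exact m.lt_succ_self
    _ ≤ _ := Set.ncard_le_ncard (Set.range_subset_iff.2 hmem) (Set.toFinite _)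

end CubeCover

end Sperner

namespace CompactAbelian

open Filter Topology

section Dimension

theorem exists_apply_notMem_of_coveringDimLE {X : Type*} [TopologicalSpace X] {n : ℕ}
    (h : CoveringDimLE X n) {A B : Fin (n + 1) → Set X} (hA : ∀ i, IsClosed (A i))
    (hB : ∀ i, IsClosed (B i)) (hAB : ∀ i, Disjoint (A i) (B i)) {ψ : (Fin (n + 1) → ℝ) → X}
    (hψ : Continuous ψ) : ∃ t i, t i = 0 ∧ ψ t ∉ A i ∨ t i = 1 ∧ ψ t ∉ B i := by
  by_contra! hface
  let F : Bool → Fin (n + 1) → Set X := fun b => if b then A else B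
  have hF : ∀ b i, IsClosed (F b i) := Bool.forall_bool.2 ⟨hB, hA⟩
  let e := Fintype.equivFin (Fin (n + 1) → Bool)
  obtain ⟨r, V, hVo, hVcover, hVF, hVn⟩ := h _ (fun k => ⋂ i, (F (e.symm k i) i)ᶜ)
    (fun k => isOpen_iInter_of_finite fun i => (hF _ i).isOpen_compl) (by
      refine Set.eq_univ_of_forall fun y => Set.mem_iUnion.2 ?_
      have hy : ∀ i, ∃ b, y ∉ F b i := fun i => by
        by_cases hyA : y ∈ A i
        · exact ⟨false, Set.disjoint_left.1 (hAB i) hyA⟩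
        · exact ⟨true, hyA⟩
      choose b hb using hy
      exact ⟨e b, Set.mem_iInter.2 fun i => by simpa using hb i⟩)
  obtain ⟨t, ht⟩ := Sperner.exists_lt_ncard_of_cover (fun j => (hVo j).preimage hψ)
    (by rw [← Set.preimage_iUnion, hVcover, Set.preimage_univ]; exact Set.subset_univ _)
    fun j i => by
      obtain ⟨k, hk⟩ := hVF j
      have hVi : V j ⊆ (F (e.symm k i) i)ᶜ := hk.trans (Set.iInter_subset _ i)
      cases hb : e.symm k i <;> rw [hb] at hVi
      · exact .inr (Set.disjoint_left.2 fun t ht h1 => hVi ht ((hface t i).2 h1))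
      · exact .inl (Set.disjoint_left.2 fun t ht h0 => hVi ht ((hface t i).1 h0))
  exact absurd (hVn (ψ t)) (not_le.2 ht)

variable {K : Type*} [AddCommGroup K] [TopologicalSpace K] [IsTopologicalAddGroup K]
  [CompactSpace K] [T2Space K]

theorem exists_continuous_lift {ι : Type*} [Finite ι] {χ : ι → (K →ₜ+ UnitAddCircle)}
    (hχ : LinearIndependent ℤ χ) :
    ∃ ψ : (ι → ℝ) → K, Continuous ψ ∧ ∀ t i, χ i (ψ t) = (t i : UnitAddCircle) := by
  classical
  have := Fintype.ofFinite ι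
  choose f hf using fun i => exists_hom_of_linearIndependent (D := ℝ) hχ (Pi.single i 1)
  choose ψ hψ using fun t : ι → ℝ => exists_eval_eq
    ((QuotientAddGroup.mk' (AddSubgroup.zmultiples (1 : ℝ))).comp
      (∑ i, (AddMonoidHom.mulLeft (t i)).comp (f i)))
  have hψt : ∀ t ρ, ρ (ψ t) = ((∑ i, t i * f i ρ : ℝ) : UnitAddCircle) := fun t ρ =>
    (hψ t ρ).trans (by simp)
  refine ⟨ψ, isInducing_evalCharacters.continuous_iff.2 (continuous_pi fun ρ => ?_), fun t i => ?_⟩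
  · exact ((AddCircle.continuous_mk' 1).comp (by fun_prop)).congr fun t => (hψt t ρ).symm
  · simp [hψt, hf, Pi.single_apply]

theorem coe_half_ne_zero : ((2⁻¹ : ℝ) : UnitAddCircle) ≠ 0 := by
  intro h
  have horder := AddCircle.addOrderOf_period_div (p := (1 : ℝ)) (n := 2) two_pos
  rw [Nat.cast_ofNat, one_div, h, addOrderOf_zero] at horder
  exact absurd horder (by norm_num)

theorem not_linearIndependent_of_coveringDimLE {n : ℕ} (h : CoveringDimLE K n)
    (χ : Fin (n + 1) → (K →ₜ+ UnitAddCircle)) : ¬ LinearIndependent ℤ χ := by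
  intro hχ
  obtain ⟨ψ, hψ, hχψ⟩ := exists_continuous_lift hχ
  have hclosed (i) (c : UnitAddCircle) : IsClosed {y | χ i y = c} :=
    isClosed_eq (χ i).continuous_toFun continuous_const
  obtain ⟨t, i, ⟨ht, hne⟩ | ⟨ht, hne⟩⟩ := exists_apply_notMem_of_coveringDimLE h
    (fun i => hclosed i 0) (fun i => hclosed i (2⁻¹ : ℝ))
    (fun i => Set.disjoint_left.2 fun y h0 h1 => coe_half_ne_zero (h1.symm.trans h0))
    (hψ.comp (continuous_const_smul (2⁻¹ : ℝ)))
  all_goals exact hne (by simp [hχψ, ht])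

theorem eq_zero_of_forall_zsmul_unitAddCircle {g : ℤ} (h : ∀ t : UnitAddCircle, g • t = 0) :
    g = 0 := by
  have hdvd := addOrderOf_dvd_iff_zsmul_eq_zero.2
    (h ((1 / (g.natAbs + 1 : ℕ) : ℝ) : UnitAddCircle))
  rw [AddCircle.addOrderOf_period_div g.natAbs.succ_pos] at hdvd
  exact Int.eq_zero_of_abs_lt_dvd hdvd (by simp)

theorem linearIndependent_of_surjective_evalCharacters {ι M : Type*} [AddCommGroup M]
    [TopologicalSpace M] {v : ι → (M →ₜ+ UnitAddCircle)}
    (hv : Function.Surjective (evalCharacters v)) : LinearIndependent ℤ v := by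
  classical
  refine linearIndependent_iff'.2 fun s g hg i hi =>
    eq_zero_of_forall_zsmul_unitAddCircle fun t => ?_
  obtain ⟨x, hx⟩ := hv (Pi.single i t)
  have hvx : ∀ j, evalAt x (v j) = Pi.single (M := fun _ => UnitAddCircle) i t j := congrFun hx
  simpa [hvx, Pi.single_apply, hi] using congrArg (evalAt x) hg

theorem finite_of_surjective_evalCharacters (h : FiniteCoveringDim K) {ι : Type*}
    {v : ι → (K →ₜ+ UnitAddCircle)} (hv : Function.Surjective (evalCharacters v)) :
    Finite ι := by
  obtain ⟨n, hn⟩ := h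
  by_contra hinfinite
  rw [not_finite_iff_infinite] at hinfinite
  exact not_linearIndependent_of_coveringDimLE hn _
    ((linearIndependent_of_surjective_evalCharacters hv).comp _
      (Fin.valEmbedding.trans (Infinite.natEmbedding ι) : Fin (n + 1) ↪ ι).injective)

end Dimension

section Traces

variable {K : Type u} [AddCommGroup K] [TopologicalSpace K] {G : AddSubgroup K}

theorem pTorsionOpen_comap {L : Type*} [AddCommGroup L] [TopologicalSpace L] {f : L →+ K}
    (hf : Continuous f) (hG : G.PTorsionOpen) : (G.comap f).PTorsionOpen := by
  intro p hp
  let F : AddSubgroup.torsionBy L (p : ℤ) → AddSubgroup.torsionBy K (p : ℤ) := fun x =>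
    ⟨f x, mem_torsionBy_iff_nsmul.2 (by rw [← map_nsmul, mem_torsionBy_iff_nsmul.1 x.2, map_zero])⟩
  have hF : Continuous F := (hf.comp continuous_subtype_val).subtype_mk _
  convert (hG p hp).preimage hF using 1
  ext x
  exact ⟨fun h => ⟨h.1, (F x).2⟩, fun h => ⟨h.1, x.2⟩⟩

theorem exists_evalCharacters_ker_eq_of_isTorus_quotient {N : AddSubgroup K}
    (hN : IsTorus (K ⧸ N)) :
    ∃ (ι : Type u) (v : ι → (K →ₜ+ UnitAddCircle)),
      Function.Surjective (evalCharacters v) ∧ (evalCharacters v).ker = N := by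
  obtain ⟨ι, ⟨e⟩⟩ := hN
  let q : K →+ (ι → UnitAddCircle) := e.toAddEquiv.toAddMonoidHom.comp (QuotientAddGroup.mk' N)
  have hq : Continuous q := e.continuous.comp continuous_quotient_mk'
  refine ⟨ι, fun i => ⟨(Pi.evalAddMonoidHom _ i).comp q, (continuous_apply i).comp hq⟩,
    e.surjective.comp (QuotientAddGroup.mk'_surjective N), AddSubgroup.ext fun x => ?_⟩
  exact (map_eq_zero_iff e e.injective).trans (QuotientAddGroup.eq_zero_iff x)

variable [IsTopologicalAddGroup K]

theorem mem_closedSocle_of_nsmul_eq_zero {p : ℕ} (hp : p.Prime) {x : K} (hx : p • x = 0) :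
    x ∈ AddSubgroup.closedSocle K :=
  AddSubgroup.le_topologicalClosure _
    (le_iSup (fun q : Nat.Primes => AddSubgroup.torsionBy K ((q : ℕ) : ℤ)) ⟨p, hp⟩
      (mem_torsionBy_iff_nsmul.2 hx))

variable [CompactSpace K] [T2Space K]

instance : CompactSpace (AddSubgroup.closedSocle K) :=
  isCompact_iff_compactSpace.1 (AddSubgroup.isClosed_topologicalClosure _).isCompact

theorem isLocallyEssential_of_pTorsionOpen (hG : G.IsWeaklyEssential) (ho : G.PTorsionOpen)
    (hfin : ((⊤ : AddSubgroup K).torsionPrimes G).Finite) : G.IsLocallyEssential :=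
  isLocallyEssential_of_containsSmallPrimeTorsion hG
    (containsSmallPrimeTorsion_of_pTorsionOpen ho hfin)

theorem isLocallyEssential_comap_of_finite_torsionPrimes (hG : G.IsWeaklyEssential)
    (ho : G.PTorsionOpen)
    (hδ : ∀ M : AddSubgroup K, M.IsDeltaSubgroup → (M.torsionPrimes G).Finite)
    {L : Type*} [AddCommGroup L] [TopologicalSpace L] [IsTopologicalAddGroup L] [CompactSpace L]
    [TotallyDisconnectedSpace L] {f : L →+ K} (hf : Continuous f) (hi : Function.Injective f) :
    (G.comap f).IsLocallyEssential := by
  have hemb : IsEmbedding f := (hf.isClosedEmbedding hi).isEmbedding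
  have : T2Space L := hemb.t2Space
  obtain ⟨M, hM, hfM⟩ := exists_isDeltaSubgroup_ge (N := f.range)
    (by simpa using (isCompact_range hf).isClosed)
    (by simpa using hemb.isTotallyDisconnected_range.2 inferInstance)
  refine isLocallyEssential_of_pTorsionOpen (isWeaklyEssential_comap hf hi hG)
    (pTorsionOpen_comap hf ho) ((hδ M hM).subset fun p hp => ⟨hp.1, fun hle => hp.2 fun x hx => ?_⟩)
  refine hle ⟨hfM ⟨x, rfl⟩, mem_torsionBy_iff_nsmul.2 ?_⟩
  rw [← map_nsmul, mem_torsionBy_iff_nsmul.1 hx.2, map_zero]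

/-- Elements of prime order lie in the closed socle, and the small ones among them in the kernel
of any finite family of its characters. -/
theorem isLocallyEssential_of_isDeltaSubgroup_closedSocle (hG : G.IsWeaklyEssential)
    (hdim : FiniteCoveringDim (AddSubgroup.closedSocle K))
    {N : AddSubgroup (AddSubgroup.closedSocle K)} (hN : N.IsDeltaSubgroup)
    (h : ((G.addSubgroupOf (AddSubgroup.closedSocle K)).addSubgroupOf N).IsLocallyEssential) :
    G.IsLocallyEssential := by
  obtain ⟨ι, v, hv, rfl⟩ := exists_evalCharacters_ker_eq_of_isTorus_quotient hN.2.2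
  have := finite_of_surjective_evalCharacters hdim hv
  refine isLocallyEssential_of_containsSmallPrimeTorsion hG ?_
  refine containsSmallPrimeTorsion_of_comap
    (f := (AddSubgroup.closedSocle K).subtype) .subtypeVal
    ⟨Set.univ, univ_mem, fun p hp x hx _ => ⟨⟨x, mem_closedSocle_of_nsmul_eq_zero hp hx⟩, rfl⟩⟩ ?_
  refine containsSmallPrimeTorsion_of_comap (f := (evalCharacters v).ker.subtype) .subtypeVal ?_
    (containsSmallPrimeTorsion_of_isLocallyEssential h)
  rw [AddSubgroup.range_subtype]
  exact containsSmallPrimeTorsion_ker_evalCharacters v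

theorem tfae_isLocallyEssential (hG : G.IsWeaklyEssential)
    (hdim : FiniteCoveringDim (AddSubgroup.closedSocle K)) :
    List.TFAE [
      G.IsLocallyEssential,
      G.PTorsionOpen ∧ ∀ M : AddSubgroup K, M.IsDeltaSubgroup → (M.torsionPrimes G).Finite,
      ∃ N : AddSubgroup (AddSubgroup.closedSocle K), N.IsDeltaSubgroup ∧
        ((G.addSubgroupOf (AddSubgroup.closedSocle K)).addSubgroupOf N).IsLocallyEssential,
      ∀ N : AddSubgroup (AddSubgroup.closedSocle K), N.IsDeltaSubgroup →
        ((G.addSubgroupOf (AddSubgroup.closedSocle K)).addSubgroupOf N).IsLocallyEssential] := by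
  tfae_have 1 → 2 := fun h =>
    have hsmall := containsSmallPrimeTorsion_of_isLocallyEssential h
    ⟨pTorsionOpen_of_containsSmallPrimeTorsion hsmall, fun M hM =>
      finite_torsionPrimes_of_containsSmallPrimeTorsion hsmall hM.1 hM.2.1⟩
  tfae_have 2 → 4 := by
    rintro ⟨ho, hδ⟩ N ⟨hNclosed, hNd, -⟩
    have : CompactSpace N := isCompact_iff_compactSpace.1 hNclosed.isCompact
    have : TotallyDisconnectedSpace N := totallyDisconnectedSpace_subtype_iff.2 hNd
    exact isLocallyEssential_comap_of_finite_torsionPrimes hG ho hδ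
      (f := (AddSubgroup.closedSocle K).subtype.comp N.subtype)
      (continuous_subtype_val.comp continuous_subtype_val)
      (Subtype.val_injective.comp Subtype.val_injective)
  tfae_have 4 → 3 := by
    intro h
    obtain ⟨N, hN, -⟩ := exists_isDeltaSubgroup_ge
      (N := (⊥ : AddSubgroup (AddSubgroup.closedSocle K)))
      isClosed_singleton isTotallyDisconnected_singleton
    exact ⟨N, hN, h N hN⟩
  tfae_have 3 → 1 := fun ⟨N, hN, h⟩ =>
    isLocallyEssential_of_isDeltaSubgroup_closedSocle hG hdim hN h
  tfae_finish

end Traces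

end CompactAbelian

open CompactAbelian in
theorem mainTheorem9 {K : Type u} [AddCommGroup K] [TopologicalSpace K]
    [IsTopologicalAddGroup K] [CompactSpace K] [T2Space K]
    (G : AddSubgroup K) (hG : G.IsWeaklyEssential) :
    (G.IsLocallyEssential →
      G.PTorsionOpen ∧
        ∃ n : ℕ, ∀ p : ℕ, p.Prime →
          pRank p (AddSubgroup.torsionBy K (p : ℤ) ⧸ G.pTorsionIn p) ≤ (n : Cardinal.{u})) ∧
    (G.PTorsionOpen → ((⊤ : AddSubgroup K).torsionPrimes G).Finite → G.IsLocallyEssential) ∧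
    (FiniteCoveringDim (AddSubgroup.closedSocle K) →
      List.TFAE [
        G.IsLocallyEssential,
        G.PTorsionOpen ∧
          ∀ M : AddSubgroup K, M.IsDeltaSubgroup → (M.torsionPrimes G).Finite,
        ∃ N : AddSubgroup (AddSubgroup.closedSocle K), N.IsDeltaSubgroup ∧
          ((G.addSubgroupOf (AddSubgroup.closedSocle K)).addSubgroupOf N).IsLocallyEssential,
        ∀ N : AddSubgroup (AddSubgroup.closedSocle K), N.IsDeltaSubgroup →
          ((G.addSubgroupOf (AddSubgroup.closedSocle K)).addSubgroupOf N).IsLocallyEssential]) ∧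
    (TotallyDisconnectedSpace K →
      (G.IsLocallyEssential ↔
        ((⊤ : AddSubgroup K).torsionPrimes G).Finite ∧ G.PTorsionOpen)) := by
  have hopen (h : G.IsLocallyEssential) : G.PTorsionOpen :=
    pTorsionOpen_of_containsSmallPrimeTorsion (containsSmallPrimeTorsion_of_isLocallyEssential h)
  refine ⟨fun h => ⟨hopen h, ?_⟩, isLocallyEssential_of_pTorsionOpen hG,
    tfae_isLocallyEssential hG, fun _ => ⟨fun h => ⟨?_, hopen h⟩, fun ⟨hfin, ho⟩ => ?_⟩⟩
  · exact exists_pRank_le_of_containsSmallPrimeTorsion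
      (containsSmallPrimeTorsion_of_isLocallyEssential h)
  · exact finite_torsionPrimes_of_containsSmallPrimeTorsion
      (containsSmallPrimeTorsion_of_isLocallyEssential h) isClosed_univ
      (isTotallyDisconnected_of_totallyDisconnectedSpace _)
  · exact isLocallyEssential_of_pTorsionOpen hG ho hfin
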